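/- **Theorem.** Let $p,q$ be integers with $1\le q<p$ and $\gcd(p,q)=1$. Let the group $\mathbb Z_p$ of complex $p$-th roots of unity (generated by $\omega=e^{2\pi i/p}$) act on the singular conifold $\operatorname{Spec}A$, $A=\mathbb C[x,y,z,t]/(xy-zt)$, by $(x,y,z,t)\mapsto(\omega x,\omega^{-1}y,\omega^{q}z,\omega^{-q}t)$, and let $\mathcal X_{p,q}=\operatorname{Spec}A^{\mathbb Z_p}$ be the orbit space. Then: 1. $\mathcal X_{p,q}$ is a normal complex variety, and it is toric: there is an open immersion $(\mathbb C^*)^3\hookrightarrow\mathcal X_{p,q}$ together with an effective algebraic action of $(\mathbb C^*)^3$ on $\mathcal X_{p,q}$ extending the action of $(\mathbb C^*)^3$ on itself by multiplication. 2. Let $\sigma\subset\mathbb R^3$ be the cone generated by $b_1=(0,1,q)$, $b_2=(0,1,q+1)$, $b_3=(p,1,1)$, $b_4=(p,1,0)$. It is strongly convex, and $b_1,\dots,b_4$ are exactly the primitive lattice generators of its rays (one-dimensional faces). For a suitable choice of the torus embedding in 1, there is an isomorphism of $\mathcal X_{p,q}$ over $\mathbb C$ with the affine toric variety $U_\sigma=\operatorname{Spec}\mathbb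 C[\sigma^\vee\cap\mathbb Z^3]$, compatible with the embeddings of $(\mathbb C^*)^3=\operatorname{Spec}\mathbb C[\mathbb Z^3]$; that is, the fan of $\mathcal X_{p,q}$ consists of the single cone $\sigma$ and its faces. 3. The $b_i$ lie on a common affine hyperplane $\{v: \langle m,v\rangle=1\}$ with $m\in\mathbb Z^3$. 4. The canonical sheaf $K_{\mathcal X_{p,q}}=(\bigwedge^3\Omega_{\mathcal X_{p,q}/\mathbb C})^{\vee\vee}$ is trivial: $K_{\mathcal X_{p,q}}\cong\mathcal O_{\mathcal X_{p,q}}$ as sheaves of modules. -/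

import Mathlib

open CategoryTheory AlgebraicGeometry MonoidalCategory MonObj
open scoped KaehlerDifferential

noncomputable section

/-! ### Toric varieties over `ℂ` -/

/-- The algebraic torus `(ℂˣ)ⁿ = Spec ℂ[ℤⁿ]`, as a scheme over `ℂ`. -/
abbrev algTorus (n : ℕ) : Over (Spec (CommRingCat.of ℂ)) :=
  (Spec (CommRingCat.of (AddMonoidAlgebra ℂ (Fin n → ℤ)))).asOver (Spec (CommRingCat.of ℂ))

/-- Its group structure, with `T × T ⟶ T` dual to the comultiplication `χᵐ ↦ χᵐ ⊗ χᵐ`. -/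
instance algTorusGrp (n : ℕ) : GrpObj (algTorus n) :=
  instGrpObjSpecAsOverSpec (R := CommRingCat.of ℂ)
    (A := CommRingCat.of (AddMonoidAlgebra ℂ (Fin n → ℤ)))

/-- Normal varieties over `ℂ`: integral separated schemes of finite type, all of whose local rings
are integrally closed. -/
structure IsNormalVariety (X : Over (Spec (CommRingCat.of ℂ))) : Prop where
  isIntegral : IsIntegral X.left
  isSeparated : IsSeparated X.hom
  locallyOfFiniteType : LocallyOfFiniteType X.hom
  quasiCompact : QuasiCompact X.hom
  isIntegrallyClosed : ∀ x : X.left, IsIntegrallyClosed (X.left.presheaf.stalk x)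

open MonoidalLeftAction in
/-- A torus embedding: an open immersion of the `n`-torus `T` into `X`, together with an effective
action of `T` on `X` which extends the action of `T` on itself by multiplication. -/
structure TorusEmbedding (n : ℕ) (X : Over (Spec (CommRingCat.of ℂ))) where
  emb : algTorus n ⟶ X
  isOpenImmersion : IsOpenImmersion emb.left
  action : ModObj (algTorus n) X
  equivariant : (algTorus n ◁ emb) ≫ action.smul = μ[algTorus n] ≫ emb
  /-- For every `ℂ`-scheme `S`, an `S`-point of `T` which acts trivially on `S × X` is the unit. -/
  effective : ∀ (S : Over (Spec (CommRingCat.of ℂ))) (g : S ⟶ algTorus n),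
    (g ▷ X) ≫ action.smul = SemiCartesianMonoidalCategory.snd S X →
      g = SemiCartesianMonoidalCategory.toUnit S ≫ η[algTorus n]

/-! ### The affine toric variety of a cone -/

section Cone

variable {n : ℕ}

/-- The image of a lattice vector of `N = ℤⁿ` in `N_ℝ = ℝⁿ`. -/
def latticeVec (v : Fin n → ℤ) : Fin n → ℝ := fun i => (v i : ℝ)

/-- The rational polyhedral cone in `N_ℝ` generated by finitely many lattice vectors. -/
def latticeCone {k : ℕ} (b : Fin k → Fin n → ℤ) : PointedCone ℝ (Fin n → ℝ) :=
  PointedCone.hull ℝ (Set.range fun i => latticeVec (b i))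

/-- The primitive generators of the rays (one-dimensional faces) of a cone: the nonzero
lattice vectors, not a proper integral multiple of a lattice vector, which span a face of `σ`. -/
def rayGenerators (σ : PointedCone ℝ (Fin n → ℝ)) : Set (Fin n → ℤ) :=
  {v | (∀ (k : ℤ) (w : Fin n → ℤ), v = k • w → IsUnit k) ∧
    (PointedCone.hull ℝ {latticeVec v}).IsFaceOf σ}

/-- The semigroup `S_σ = σ^∨ ∩ M`, where `M = ℤⁿ` is paired with `N` by the dot product. -/
def dualMonoid (σ : PointedCone ℝ (Fin n → ℝ)) : AddSubmonoid (Fin n → ℤ) where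
  carrier := {m | ∀ x ∈ σ, 0 ≤ latticeVec m ⬝ᵥ x}
  zero_mem' := fun x _ => by simp [latticeVec, dotProduct]
  add_mem' := fun {a b} ha hb x hx => by
    have h : latticeVec (a + b) = latticeVec a + latticeVec b := by
      ext i
      simp [latticeVec]
    rw [h, add_dotProduct]
    exact add_nonneg (ha x hx) (hb x hx)

/-- The affine toric variety `U_σ = Spec ℂ[S_σ]`; for a strongly convex rational polyhedral cone
`σ` this is the toric variety of the fan which consists of `σ` and its faces. -/
def affineToric (σ : PointedCone ℝ (Fin n → ℝ)) : Over (Spec (CommRingCat.of ℂ)) :=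
  (Spec (CommRingCat.of (AddMonoidAlgebra ℂ (dualMonoid σ)))).asOver (Spec (CommRingCat.of ℂ))

/-- The canonical morphism `T = Spec ℂ[M] ⟶ U_σ` given by the inclusion `ℂ[S_σ] ⊆ ℂ[M]`. -/
def affineToricEmb (σ : PointedCone ℝ (Fin n → ℝ)) : algTorus n ⟶ affineToric σ :=
  (Spec.map (CommRingCat.ofHom
    (AddMonoidAlgebra.mapDomainAlgHom ℂ ℂ (dualMonoid σ).subtype).toRingHom)).asOver
      (Spec (CommRingCat.of ℂ))

end Cone

/-! ### The canonical sheaf -/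

/-- The canonical sheaf of the normal affine variety `Spec R` of dimension `n` over `ℂ`: the
reflexive hull `(⋀ⁿ Ω_{R/ℂ})^{∨∨}` of the sheaf of top differential forms. -/
def canonicalSheaf (n : ℕ) (R : Type) [CommRing R] [Algebra ℂ R] :
    (Spec (CommRingCat.of R)).Modules :=
  tilde (R := CommRingCat.of R)
    (ModuleCat.of R (Module.Dual R (Module.Dual R (⋀[R]^n Ω[R⁄ℂ]))))

/-! ### The quotient of the conifold -/

/-- The coordinate ring `ℂ[x, y, z, t] / (xy - zt)` of the singular conifold. -/
abbrev ConifoldRing : Type :=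
  MvPolynomial (Fin 4) ℂ ⧸
    Ideal.span {(MvPolynomial.X 0 * MvPolynomial.X 1 - MvPolynomial.X 2 * MvPolynomial.X 3 :
      MvPolynomial (Fin 4) ℂ)}

/-- The factors by which `ζ` multiplies the coordinates: `(x,y,z,t) ↦ (ζ x, ζ⁻¹ y, ζ^q z, ζ^{-q} t)`. -/
def conifoldWeight (q : ℕ) (ζ : ℂˣ) : Fin 4 → ℂˣ := ![ζ, ζ⁻¹, ζ ^ q, (ζ ^ q)⁻¹]

/-- The substitution `(x,y,z,t) ↦ (ζ x, ζ⁻¹ y, ζ^q z, ζ^{-q} t)` in functions on the conifold. -/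
def conifoldSubst (q : ℕ) (ζ : ℂˣ) : ConifoldRing →ₐ[ℂ] ConifoldRing :=
  Ideal.quotientMapₐ _
    (MvPolynomial.aeval fun i =>
      MvPolynomial.C (conifoldWeight q ζ i : ℂ) * MvPolynomial.X i) <| by
    rw [Ideal.span_le, Set.singleton_subset_iff]
    refine Ideal.subset_span ?_
    have h1 : (MvPolynomial.C (ζ : ℂ) * MvPolynomial.C ((ζ⁻¹ : ℂˣ) : ℂ) :
        MvPolynomial (Fin 4) ℂ) = 1 := by
      rw [← MvPolynomial.C_mul, Units.mul_inv, MvPolynomial.C_1]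
    have h2 : (MvPolynomial.C ((ζ ^ q : ℂˣ) : ℂ) * MvPolynomial.C (((ζ ^ q)⁻¹ : ℂˣ) : ℂ) :
        MvPolynomial (Fin 4) ℂ) = 1 := by
      rw [← MvPolynomial.C_mul, Units.mul_inv, MvPolynomial.C_1]
    simp only [map_sub, map_mul, MvPolynomial.aeval_X, conifoldWeight,
      Set.mem_singleton_iff, Matrix.cons_val]
    linear_combination (MvPolynomial.X 0 * MvPolynomial.X 1) * h1 -
      (MvPolynomial.X 2 * MvPolynomial.X 3) * h2

/-- The coordinate ring of the orbit space `𝒳_{p,q}` of the conifold under `ℤ_p`, the group of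
`p`-th roots of unity: the subring of invariant functions. -/
def conifoldInvariants (p q : ℕ) : Subalgebra ℂ ConifoldRing :=
  ⨅ ζ ∈ rootsOfUnity p ℂ, AlgHom.equalizer (conifoldSubst q ζ) (AlgHom.id ℂ ConifoldRing)

/-- The quotient `𝒳_{p,q} = Spec (ℂ[x, y, z, t] / (xy - zt))^{ℤ_p}` of the singular conifold. -/
def conifoldQuotient (p q : ℕ) : Over (Spec (CommRingCat.of ℂ)) :=
  (Spec (CommRingCat.of (conifoldInvariants p q))).asOver (Spec (CommRingCat.of ℂ))

/-- The generators of the rays of the fan of `𝒳_{p,q}`. -/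
def conifoldRays (p q : ℕ) : Fin 4 → Fin 3 → ℤ :=
  ![![0, 1, q], ![0, 1, q + 1], ![p, 1, 1], ![p, 1, 0]]

end

/-! Everything is compared inside the Cox ring `ℂ[y₁, y₂, y₃, y₄]`. The substitution x = y₁y₂, y =
y₃y₄, z = y₁y₄, t = y₂y₃ embeds the conifold ring as the span of the monomials y^s with s₁ + s₃ = s₂
+ s₄. The action of a root of unity lifts to a diagonal one, so the invariants are spanned by those
y^s which also satisfy a congruence mod p (`mem_range_invariantsCox`). Pairing a lattice point of
σ^∨ with the four ray generators gives exactly the same exponents (`range_rayPairing`), whence the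
invariant ring is ℂ[S_σ] (`invariantsEquiv`).

Normality: the exponent set is closed under those differences that exist in ℕ⁴, so the invariant
ring contains every quotient of its elements that lies in the factorial Cox ring
(`isIntegrallyClosed_conifoldInvariants`). Finite generation is the Artin–Tate lemma. The torus
embedding comes from the monoid structure of U_σ: T is an open submonoid and acts by multiplication.

Canonical sheaf: χ^{-a} g(dχ^a) is additive in a for every linear g on Ω, so alternating 3-forms
with values in ℂ[ℤ³] are multiples F·ω of the form ω sending (dχ^a, dχ^b, dχ^c) to det(a, b, c)
χ^{a+b+c}. Let m = (0,1,0), which pairs to 1 with every ray generator. A multiple F·ω takes values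
in R exactly when F·χ^m lies in R. So χ^{-m}ω freely generates the dual of ⋀³Ω, and the double dual
is free of rank one (`nonempty_dual_dual_exteriorPower_equiv`). -/

noncomputable section

/-! ### The cone σ: strong convexity and rays -/

section ConifoldCone

theorem mem_latticeCone_iff {n k : ℕ} {b : Fin k → Fin n → ℤ} {x : Fin n → ℝ} :
    x ∈ latticeCone b ↔ ∃ c : Fin k → ℝ, (∀ i, 0 ≤ c i) ∧ x = ∑ i, c i • latticeVec (b i) := by
  rw [latticeCone, PointedCone.hull, Submodule.mem_span_range_iff_exists_fun]
  constructor
  · rintro ⟨c, rfl⟩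
    exact ⟨fun i => c i, fun i => (c i).2, rfl⟩
  · rintro ⟨c, hc, rfl⟩
    exact ⟨fun i => ⟨c i, hc i⟩, rfl⟩

theorem latticeVec_dotProduct {n : ℕ} (a b : Fin n → ℤ) :
    latticeVec a ⬝ᵥ latticeVec b = ((a ⬝ᵥ b : ℤ) : ℝ) := by
  simp [latticeVec, dotProduct]

theorem mem_dualMonoid_latticeCone {n k : ℕ} {b : Fin k → Fin n → ℤ} {m : Fin n → ℤ} :
    m ∈ dualMonoid (latticeCone b) ↔ ∀ i, 0 ≤ m ⬝ᵥ b i := by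
  constructor
  · intro h i
    have := h (latticeVec (b i)) (Submodule.subset_span ⟨i, rfl⟩)
    rw [latticeVec_dotProduct] at this
    exact_mod_cast this
  · intro h x hx
    obtain ⟨c, hc, rfl⟩ := mem_latticeCone_iff.1 hx
    rw [dotProduct_sum]
    refine Finset.sum_nonneg fun i _ => ?_
    rw [dotProduct_smul, latticeVec_dotProduct, smul_eq_mul]
    exact mul_nonneg (hc i) (by exact_mod_cast h i)

variable {p q : ℕ}

/-- All generators have second coordinate 1, so the coefficients of x and of -x are nonnegative
numbers with total sum 0. -/
theorem salient_conifoldCone :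
    (latticeCone (conifoldRays p q) : ConvexCone ℝ (Fin 3 → ℝ)).Salient := by
  intro x hx hx0 hx'
  obtain ⟨c, hc, rfl⟩ := mem_latticeCone_iff.1 hx
  obtain ⟨d, hd, h⟩ := mem_latticeCone_iff.1 hx'
  apply hx0
  have h1 := congrFun h 1
  simp [Fin.sum_univ_four, conifoldRays, latticeVec] at h1
  have := hc 0; have := hc 1; have := hc 2; have := hc 3
  have := hd 0; have := hd 1; have := hd 2; have := hd 3
  have e0 : c 0 = 0 := by linarith
  have e1 : c 1 = 0 := by linarith
  have e2 : c 2 = 0 := by linarith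
  have e3 : c 3 = 0 := by linarith
  simp [Fin.sum_univ_four, e0, e1, e2, e3]

/-- Real linear forms which are nonnegative on the cone and vanish on exactly one ray. -/
theorem exists_supporting_form (hp : 0 < p) (i : Fin 4) :
    ∃ h : Fin 3 → ℝ, h ⬝ᵥ latticeVec (conifoldRays p q i) = 0 ∧
      ∀ j, j ≠ i → 0 < h ⬝ᵥ latticeVec (conifoldRays p q j) := by
  have hp' : (p : ℝ) ≠ 0 := by positivity
  have key (h : Fin 3 → ℝ) (j : Fin 4) : h ⬝ᵥ latticeVec (conifoldRays p q j) =
      ![h 1 + q * h 2, h 1 + (q + 1) * h 2, p * h 0 + h 1 + h 2, p * h 0 + h 1] j := by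
    fin_cases j <;> simp [conifoldRays, latticeVec, dotProduct, Fin.sum_univ_three] <;> ring
  simp only [key]
  fin_cases i
  -- In each case the form is chosen so that its value on a generator is the distance from bᵢ around
  -- the quadrilateral b₁b₂b₃b₄: 0 on bᵢ, 1 on its neighbours, 2 on the opposite generator.
  · refine ⟨![(1 + q) / p, -q, 1], ?_⟩
    simp [Fin.forall_fin_succ, mul_div_cancel₀ _ hp']
  · refine ⟨![(1 - q) / p, q + 1, -1], ?_⟩
    simp [Fin.forall_fin_succ, mul_div_cancel₀ _ hp']
    constructor <;> linarith
  · refine ⟨![(-1 - q) / p, q + 2, -1], ?_⟩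
    simp [Fin.forall_fin_succ, mul_div_cancel₀ _ hp']
    ring_nf
    norm_num
  · refine ⟨![(-1 + q) / p, 1 - q, 1], ?_⟩
    simp [Fin.forall_fin_succ, mul_div_cancel₀ _ hp']
    linarith

theorem conifoldRays_one (i : Fin 4) : conifoldRays p q i 1 = 1 := by
  fin_cases i <;> rfl

/-- A supporting form vanishes on a • x + y and is nonnegative on both summands, so it kills x; then
only bᵢ can occur in x. -/
theorem isFaceOf_hull_conifoldRays (hp : 0 < p) (i : Fin 4) :
    (PointedCone.hull ℝ {latticeVec (conifoldRays p q i)}).IsFaceOf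
      (latticeCone (conifoldRays p q)) where
  le := Submodule.span_mono (Set.singleton_subset_iff.2 ⟨i, rfl⟩)
  mem_of_smul_add_mem {x y a} hx hy ha hxy := by
    obtain ⟨h, h0, hpos⟩ := exists_supporting_form (q := q) hp i
    have hnn (j) : 0 ≤ h ⬝ᵥ latticeVec (conifoldRays p q j) := by
      by_cases hj : j = i
      · rw [hj, h0]
      · exact (hpos j hj).le
    obtain ⟨t, ht⟩ := Submodule.mem_span_singleton.1 hxy
    have hz : h ⬝ᵥ (a • x + y) = 0 := by
      rw [← ht]
      change h ⬝ᵥ ((t : ℝ) • _) = 0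
      rw [dotProduct_smul, h0, smul_zero]
    obtain ⟨c, hc, rfl⟩ := mem_latticeCone_iff.1 hx
    obtain ⟨d, hd, rfl⟩ := mem_latticeCone_iff.1 hy
    simp only [dotProduct_add, dotProduct_smul, dotProduct_sum, smul_eq_mul] at hz
    have h1 : 0 ≤ ∑ j, c j * (h ⬝ᵥ latticeVec (conifoldRays p q j)) :=
      Finset.sum_nonneg fun j _ => mul_nonneg (hc j) (hnn j)
    have h2 : 0 ≤ ∑ j, d j * (h ⬝ᵥ latticeVec (conifoldRays p q j)) :=
      Finset.sum_nonneg fun j _ => mul_nonneg (hd j) (hnn j)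
    have h3 : ∑ j, c j * (h ⬝ᵥ latticeVec (conifoldRays p q j)) = 0 := by nlinarith
    rw [Finset.sum_eq_zero_iff_of_nonneg fun j _ => mul_nonneg (hc j) (hnn j)] at h3
    have h4 (j) (hj : j ≠ i) : c j = 0 := by
      simpa [(hpos j hj).ne'] using h3 j (Finset.mem_univ j)
    rw [Finset.sum_eq_single i (fun j _ hj => by rw [h4 j hj, zero_smul]) (by simp)]
    exact Submodule.smul_mem _ (⟨c i, hc i⟩ : NNReal) (Submodule.mem_span_singleton_self _)

/-- A face containing v contains every bᵢ that occurs in v with positive coefficient, so a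
one-dimensional one forces v to be a positive multiple of some bᵢ. Since the second coordinate of bᵢ
is 1, the multiple is the integer `v 1`, and primitivity makes it 1. The same coordinate shows that
bᵢ is primitive. -/
theorem rayGenerators_conifoldCone (hp : 0 < p) :
    rayGenerators (latticeCone (conifoldRays p q)) = Set.range (conifoldRays p q) := by
  ext v
  constructor
  · rintro ⟨hprim, hface⟩
    obtain ⟨c, hc, hv⟩ := mem_latticeCone_iff.1 (hface.le (Submodule.mem_span_singleton_self _))
    have hi : ∃ i, 0 < c i := by
      by_contra! hle
      have hv0 : v = 0 := by
        ext j
        have : latticeVec v = 0 := by simpa [fun i => le_antisymm (hle i) (hc i)] using hv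
        simpa [latticeVec] using congrFun this j
      -- The zero vector is not primitive: 0 = 2 • 0, and 2 is not a unit.
      exact absurd (hprim 2 0 (by simp [hv0])) (by decide)
    obtain ⟨i, hi⟩ := hi
    have hmem : latticeVec (conifoldRays p q i) ∈ PointedCone.hull ℝ {latticeVec v} :=
      hface.mem_of_sum_smul_mem (c := c) (f := fun i => latticeVec (conifoldRays p q i))
        (fun j => Submodule.subset_span ⟨j, rfl⟩) hc
        (hv ▸ Submodule.mem_span_singleton_self _) i hi
    obtain ⟨t, ht⟩ := Submodule.mem_span_singleton.1 hmem
    have ht (j) : (t : ℝ) * v j = conifoldRays p q i j := congrFun ht j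
    have h1 : (t : ℝ) * v 1 = 1 := by rw [ht, conifoldRays_one]; norm_num
    have hvk : v = v 1 • conifoldRays p q i := by
      ext j
      have : (v j : ℝ) = v 1 * conifoldRays p q i j := by
        rw [← ht]; linear_combination - (v j : ℝ) * h1
      exact_mod_cast this
    have hpos : (0 : ℝ) < v 1 := by
      have := t.2
      by_contra! hneg
      nlinarith
    have hpos : 0 < v 1 := by exact_mod_cast hpos
    have hone : v 1 = 1 := by
      rcases Int.isUnit_iff.1 (hprim _ _ hvk) with h | h <;> omega
    exact ⟨i, by rw [hvk, hone, one_smul]⟩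
  · rintro ⟨i, rfl⟩
    refine ⟨fun k w h => ?_, isFaceOf_hull_conifoldRays hp i⟩
    have := congrFun h 1
    rw [conifoldRays_one] at this
    exact IsUnit.of_mul_eq_one _ this.symm

end ConifoldCone

/-! ### Images of maps of monoid algebras -/

section MonoidAlgebraRange

theorem AddMonoidAlgebra.mem_range_mapDomainAlgHom_iff {k M N : Type*} [CommSemiring k]
    [AddCommMonoid M] [AddCommMonoid N] (g : M →+ N) (f : AddMonoidAlgebra k N) :
    f ∈ (AddMonoidAlgebra.mapDomainAlgHom k k g).range ↔
      ∀ s ∈ f.coeff.support, s ∈ Set.range g := by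
  classical
  constructor
  · rintro ⟨f, rfl⟩ s hs
    obtain ⟨t, -, rfl⟩ := Finset.mem_image.1 (Finsupp.mapDomain_support hs)
    exact ⟨t, rfl⟩
  · intro h
    rw [← f.sum_coeff_single]
    refine sum_mem fun s hs => ?_
    obtain ⟨t, rfl⟩ := h s hs
    exact ⟨.single t (f.coeff (g t)), by simp⟩

end MonoidAlgebraRange

/-! ### Cox coordinates, invariant monomials and the identification with ℂ[S_σ] -/

section ConifoldCox

/-- The exponents in `y₁, y₂, y₃, y₄` of a monomial in `x = y₁y₂`, `y = y₃y₄`, `z = y₁y₄`,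
`t = y₂y₃`. -/
def conifoldExponent : (Fin 4 →₀ ℕ) →+ (Fin 4 →₀ ℕ) where
  toFun s := Finsupp.equivFunOnFinite.symm ![s 0 + s 2, s 0 + s 3, s 1 + s 3, s 1 + s 2]
  map_zero' := by ext i; fin_cases i <;> simp
  map_add' s t := by ext i; fin_cases i <;> simp <;> ring

theorem conifoldExponent_apply (s : Fin 4 →₀ ℕ) :
    ⇑(conifoldExponent s) = ![s 0 + s 2, s 0 + s 3, s 1 + s 3, s 1 + s 2] := rfl

theorem mem_range_conifoldExponent {s : Fin 4 →₀ ℕ} :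
    s ∈ Set.range conifoldExponent ↔ s 0 + s 2 = s 1 + s 3 := by
  constructor
  · rintro ⟨t, rfl⟩
    simp [conifoldExponent_apply]; ring
  · intro h
    -- The preimage takes z = y₁y₄ as often as possible. The surplus of y₁ or of y₄ then gives the
    -- power of x or of y, and the remaining y₂ gives t.
    refine ⟨Finsupp.equivFunOnFinite.symm
      ![s 0 - s 3, s 3 - s 0, min (s 0) (s 3), s 1 - (s 0 - s 3)], ?_⟩
    ext i
    fin_cases i <;> simp [conifoldExponent_apply] <;> omega

/-- The substitution `x = y₁y₂`, `y = y₃y₄`, `z = y₁y₄`, `t = y₂y₃` before passing to the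
quotient by `xy - zt`. -/
def conifoldCoxPoly : MvPolynomial (Fin 4) ℂ →ₐ[ℂ] MvPolynomial (Fin 4) ℂ :=
  AddMonoidAlgebra.mapDomainAlgHom ℂ ℂ conifoldExponent

theorem conifoldCoxPoly_monomial (s : Fin 4 →₀ ℕ) (c : ℂ) :
    conifoldCoxPoly (MvPolynomial.monomial s c) = MvPolynomial.monomial (conifoldExponent s) c :=
  AddMonoidAlgebra.mapDomain_single ..

/-- The conifold as a quotient of affine space: `x = y₁y₂`, `y = y₃y₄`, `z = y₁y₄`, `t = y₂y₃`. -/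
def conifoldCox : ConifoldRing →ₐ[ℂ] MvPolynomial (Fin 4) ℂ :=
  Ideal.Quotient.liftₐ _ conifoldCoxPoly <| by
    intro a ha
    rw [← RingHom.mem_ker] at *
    revert a
    change _ ≤ RingHom.ker conifoldCoxPoly
    rw [Ideal.span_le, Set.singleton_subset_iff]
    simp only [MvPolynomial.X, MvPolynomial.monomial_mul, SetLike.mem_coe, RingHom.mem_ker,
      map_sub, conifoldCoxPoly_monomial, sub_eq_zero]
    congr 2
    ext i
    fin_cases i <;> simp [conifoldExponent_apply]

/-- Every function on the conifold is represented by a polynomial without monomials divisible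
by `xy`. -/
theorem exists_reduced_representative (f : ConifoldRing) :
    ∃ g : MvPolynomial (Fin 4) ℂ, Ideal.Quotient.mk _ g = f ∧
      ∀ s ∈ g.support, s 0 = 0 ∨ s 1 = 0 := by
  classical
  obtain ⟨f, rfl⟩ := Ideal.Quotient.mk_surjective f
  induction f using MvPolynomial.induction_on' with
  | monomial u a =>
    let k := min (u 0) (u 1)
    let s : Fin 4 →₀ ℕ := Finsupp.equivFunOnFinite.symm ![u 0 - k, u 1 - k, u 2, u 3]
    refine ⟨MvPolynomial.monomial s a * (MvPolynomial.X 2 * MvPolynomial.X 3) ^ k, ?_, ?_⟩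
    · have hu : (MvPolynomial.monomial u a : MvPolynomial (Fin 4) ℂ) =
          MvPolynomial.monomial s a * (MvPolynomial.X 0 * MvPolynomial.X 1) ^ k := by
        simp only [MvPolynomial.X, MvPolynomial.monomial_mul, MvPolynomial.monomial_pow, one_pow,
          _root_.mul_one]
        refine congrArg₂ (fun s a => MvPolynomial.monomial s a) ?_ rfl
        ext i
        fin_cases i <;> simp [s, k]
      have hrel : Ideal.Quotient.mk (Ideal.span {(MvPolynomial.X 0 * MvPolynomial.X 1 -
          MvPolynomial.X 2 * MvPolynomial.X 3 : MvPolynomial (Fin 4) ℂ)})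
          (MvPolynomial.X 2 * MvPolynomial.X 3) =
          Ideal.Quotient.mk _ (MvPolynomial.X 0 * MvPolynomial.X 1) :=
        (Ideal.Quotient.eq.2 (Ideal.subset_span (Set.mem_singleton _))).symm
      rw [hu, map_mul, map_mul, map_pow, map_pow, hrel]
    · intro t ht
      simp only [MvPolynomial.X, MvPolynomial.monomial_mul, MvPolynomial.monomial_pow, one_pow,
        _root_.mul_one] at ht
      rw [Finset.mem_singleton.1 (MvPolynomial.support_monomial_subset ht)]
      simp [s, k]
      omega
  | add f g hf hg =>
    obtain ⟨f', hf', hf⟩ := hf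
    obtain ⟨g', hg', hg⟩ := hg
    refine ⟨f' + g', by rw [map_add, hf', hg', map_add], fun s hs => ?_⟩
    exact (Finset.mem_union.1 (MvPolynomial.support_add hs)).elim (hf s) (hg s)

/-- Monomials with equal image differ by a power of xy/(zt), so the exponent map is injective on
monomials not divisible by xy, and these represent every class. -/
theorem conifoldCox_injective : Function.Injective conifoldCox := by
  rw [injective_iff_map_eq_zero]
  intro f hf
  obtain ⟨g, rfl, hg⟩ := exists_reduced_representative f
  have hf' : Finsupp.mapDomain conifoldExponent (AddMonoidAlgebra.coeff g) = 0 :=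
    congrArg AddMonoidAlgebra.coeff (hf : conifoldCoxPoly g = 0)
  suffices AddMonoidAlgebra.coeff g = 0 by rw [AddMonoidAlgebra.coeff_eq_zero.1 this, map_zero]
  refine Finsupp.mapDomain_injOn {s : Fin 4 →₀ ℕ | s 0 = 0 ∨ s 1 = 0} ?_ hg (by simp)
    (hf'.trans Finsupp.mapDomain_zero.symm)
  intro s hs t ht h
  have h0 := DFunLike.congr_fun h 0
  have h1 := DFunLike.congr_fun h 1
  have h2 := DFunLike.congr_fun h 2
  have h3 := DFunLike.congr_fun h 3
  simp [conifoldExponent_apply] at h0 h1 h2 h3 hs ht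
  ext i
  fin_cases i <;> simp <;> omega

theorem mem_range_conifoldCox {f : MvPolynomial (Fin 4) ℂ} :
    f ∈ conifoldCox.range ↔ ∀ s ∈ f.support, s 0 + s 2 = s 1 + s 3 := by
  simp only [← mem_range_conifoldExponent]
  refine Iff.trans ?_ (AddMonoidAlgebra.mem_range_mapDomainAlgHom_iff conifoldExponent f)
  constructor
  · rintro ⟨g, rfl⟩
    obtain ⟨g, rfl⟩ := Ideal.Quotient.mk_surjective g
    exact ⟨g, rfl⟩
  · rintro ⟨g, rfl⟩
    exact ⟨Ideal.Quotient.mk _ g, rfl⟩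

/-- The lift to affine space of the action of `ζ` on the conifold. -/
def coxTwist (q : ℕ) (ζ : ℂˣ) : MvPolynomial (Fin 4) ℂ →ₐ[ℂ] MvPolynomial (Fin 4) ℂ :=
  MvPolynomial.aeval fun i =>
    -- The weights q, 1 - q, -1, 0 give x, y, z, t the weights 1, -1, q, -q; fixing y₄ determines
    -- the lift.
    MvPolynomial.C (![(ζ : ℂ) ^ q, ζ * ((ζ ^ q)⁻¹ : ℂˣ), (ζ⁻¹ : ℂˣ), 1] i) * MvPolynomial.X i

theorem conifoldCox_mk_X (i : Fin 4) : conifoldCox (Ideal.Quotient.mk _ (MvPolynomial.X i)) =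
    MvPolynomial.X (![0, 2, 0, 1] i) * MvPolynomial.X (![1, 3, 3, 2] i) := by
  change conifoldCoxPoly _ = _
  simp only [MvPolynomial.X, MvPolynomial.monomial_mul, conifoldCoxPoly_monomial, _root_.mul_one]
  refine congrArg₂ (fun s a => MvPolynomial.monomial s a) ?_ rfl
  ext j
  fin_cases i <;> fin_cases j <;> simp [conifoldExponent_apply]

theorem conifoldSubst_mk_X (q : ℕ) (ζ : ℂˣ) (i : Fin 4) :
    conifoldSubst q ζ (Ideal.Quotient.mk _ (MvPolynomial.X i)) =
      (conifoldWeight q ζ i : ℂ) • Ideal.Quotient.mk _ (MvPolynomial.X i) := by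
  change Ideal.Quotient.mk _ (MvPolynomial.aeval _ _) = Ideal.Quotient.mk _ (_ • MvPolynomial.X i)
  rw [MvPolynomial.aeval_X, MvPolynomial.smul_eq_C_mul]

theorem conifoldCox_conifoldSubst (q : ℕ) (ζ : ℂˣ) (f : ConifoldRing) :
    conifoldCox (conifoldSubst q ζ f) = coxTwist q ζ (conifoldCox f) := by
  suffices conifoldCox.comp (conifoldSubst q ζ) = (coxTwist q ζ).comp conifoldCox from
    DFunLike.congr_fun this f
  apply Ideal.Quotient.algHom_ext
  apply MvPolynomial.algHom_ext
  intro i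
  change conifoldCox (conifoldSubst q ζ (Ideal.Quotient.mk _ (MvPolynomial.X i))) =
    coxTwist q ζ (conifoldCox (Ideal.Quotient.mk _ (MvPolynomial.X i)))
  have hw : (conifoldWeight q ζ i : ℂ) =
      ![(ζ : ℂ) ^ q, ζ * ((ζ ^ q)⁻¹ : ℂˣ), (ζ⁻¹ : ℂˣ), 1] (![0, 2, 0, 1] i) *
      ![(ζ : ℂ) ^ q, ζ * ((ζ ^ q)⁻¹ : ℂˣ), (ζ⁻¹ : ℂˣ), 1] (![1, 3, 3, 2] i) := by
    have := ζ.ne_zero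
    fin_cases i <;> simp [conifoldWeight] <;> field_simp
  rw [conifoldSubst_mk_X, map_smul, conifoldCox_mk_X, map_mul, coxTwist, MvPolynomial.aeval_X,
    MvPolynomial.aeval_X, hw, MvPolynomial.smul_eq_C_mul, MvPolynomial.C_mul]
  ring

theorem coeff_coxTwist (q : ℕ) (ζ : ℂˣ) (f : MvPolynomial (Fin 4) ℂ) (s : Fin 4 →₀ ℕ) :
    (coxTwist q ζ f).coeff s =
      ((ζ ^ (q * s 0 + (1 - q) * s 1 - s 2 : ℤ) : ℂˣ) : ℂ) * f.coeff s := by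
  classical
  induction f using MvPolynomial.induction_on' with
  | monomial u a =>
    have hu : coxTwist q ζ (MvPolynomial.monomial u a) =
        MvPolynomial.monomial u (((ζ ^ (q * u 0 + (1 - q) * u 1 - u 2 : ℤ) : ℂˣ) : ℂ) * a) := by
      rw [coxTwist, MvPolynomial.aeval_monomial, Finsupp.prod_fintype _ _ (by simp)]
      simp only [mul_pow, Finset.prod_mul_distrib, ← MvPolynomial.C_pow, ← map_prod]
      rw [MvPolynomial.algebraMap_eq, ← _root_.mul_assoc, ← MvPolynomial.C_mul,
        MvPolynomial.monomial_eq, Finsupp.prod_fintype _ _ (by simp)]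
      congr 2
      rw [mul_comm a]
      congr 1
      have := ζ.ne_zero
      simp [Fin.prod_univ_four]
      rw [zpow_sub₀ this, zpow_add₀ this, sub_mul, zpow_sub₀ this]
      simp [zpow_mul, mul_pow]
      field_simp
    rw [hu, MvPolynomial.coeff_monomial, MvPolynomial.coeff_monomial]
    split_ifs with h
    · rw [h]
    · simp
  | add f g hf hg => rw [map_add, MvPolynomial.coeff_add, hf, hg, MvPolynomial.coeff_add, mul_add]

/-- The exponents of the functions on the quotient of the conifold. -/
def coxExponents (p q : ℕ) : Set (Fin 4 →₀ ℕ) :=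
  {s | s 0 + s 2 = s 1 + s 3 ∧ (p : ℤ) ∣ (s 0 - s 3 + q * (s 0 - s 1) : ℤ)}

theorem mem_conifoldInvariants_iff {p q : ℕ} {f : ConifoldRing} :
    f ∈ conifoldInvariants p q ↔ ∀ ζ ∈ rootsOfUnity p ℂ, conifoldSubst q ζ f = f := by
  simp [conifoldInvariants, Algebra.mem_iInf, AlgHom.mem_equalizer]

/-- The lifted action is diagonal on monomials, so invariance is tested monomial by monomial; a
primitive p-th root of unity turns it into divisibility of the weight by p. -/
theorem mem_conifoldInvariants_iff_conifoldCox {p q : ℕ} (hp : p ≠ 0) {f : ConifoldRing} :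
    f ∈ conifoldInvariants p q ↔ ∀ s ∈ (conifoldCox f).support, s ∈ coxExponents p q := by
  have hrange := mem_range_conifoldCox.1 ⟨f, rfl⟩
  have hexp (s : Fin 4 →₀ ℕ) (hs : s 0 + s 2 = s 1 + s 3) :
      (q * s 0 + (1 - q) * s 1 - s 2 : ℤ) = s 0 - s 3 + q * (s 0 - s 1) := by
    have : (s 0 + s 2 : ℤ) = s 1 + s 3 := by exact_mod_cast hs
    linear_combination -this
  rw [mem_conifoldInvariants_iff]
  simp only [← conifoldCox_injective.eq_iff, conifoldCox_conifoldSubst]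
  constructor
  · intro h s hs
    have hprim := Complex.isPrimitiveRoot_exp p hp
    obtain ⟨ζ, hζ⟩ := hprim.isUnit hp
    rw [← hζ, IsPrimitiveRoot.coe_units_iff] at hprim
    refine ⟨hrange s hs, ?_⟩
    rw [← hexp s (hrange s hs), ← hprim.zpow_eq_one_iff_dvd]
    have := congrArg (MvPolynomial.coeff s) (h ζ hprim.pow_eq_one)
    rw [coeff_coxTwist] at this
    exact Units.ext (mul_right_cancel₀ (MvPolynomial.mem_support_iff.1 hs)
      (this.trans (_root_.one_mul _).symm))
  · intro h ζ hζ
    ext s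
    rw [coeff_coxTwist]
    by_cases hs : s ∈ (conifoldCox f).support
    · obtain ⟨h1, k, hk⟩ := h s hs
      rw [hexp s h1, hk, zpow_mul, zpow_natCast, hζ]
      simp
    · rw [MvPolynomial.notMem_support_iff.1 hs, mul_zero]

/-- The embedding of the functions on the quotient of the conifold into the Cox ring. -/
def invariantsCox (p q : ℕ) : conifoldInvariants p q →ₐ[ℂ] MvPolynomial (Fin 4) ℂ :=
  conifoldCox.comp (conifoldInvariants p q).val

theorem invariantsCox_injective (p q : ℕ) : Function.Injective (invariantsCox p q) :=
  conifoldCox_injective.comp Subtype.val_injective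

theorem mem_range_invariantsCox {p q : ℕ} (hp : p ≠ 0) {f : MvPolynomial (Fin 4) ℂ} :
    f ∈ (invariantsCox p q).range ↔ ∀ s ∈ f.support, s ∈ coxExponents p q := by
  constructor
  · rintro ⟨g, rfl⟩
    exact (mem_conifoldInvariants_iff_conifoldCox hp).1 g.2
  · intro h
    obtain ⟨g, rfl⟩ := mem_range_conifoldCox.2 fun s hs => (h s hs).1
    exact ⟨⟨g, (mem_conifoldInvariants_iff_conifoldCox hp).2 h⟩, rfl⟩

/-- The pairings of a lattice point of the dual cone with the ray generators. -/
def rayPairing (p q : ℕ) : dualMonoid (latticeCone (conifoldRays p q)) →+ (Fin 4 →₀ ℕ) where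
  toFun m := Finsupp.equivFunOnFinite.symm fun i => ((m : Fin 3 → ℤ) ⬝ᵥ conifoldRays p q i).toNat
  map_zero' := by ext; simp
  map_add' m n := by
    ext i
    have hm := mem_dualMonoid_latticeCone.1 m.2 i
    have hn := mem_dualMonoid_latticeCone.1 n.2 i
    simp [add_dotProduct, Int.toNat_add hm hn]

theorem rayPairing_apply {p q : ℕ} (m : dualMonoid (latticeCone (conifoldRays p q))) (i : Fin 4) :
    (rayPairing p q m i : ℤ) = (m : Fin 3 → ℤ) ⬝ᵥ conifoldRays p q i :=
  Int.toNat_of_nonneg (mem_dualMonoid_latticeCone.1 m.2 i)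

theorem dotProduct_conifoldRays (p q : ℕ) (m : Fin 3 → ℤ) :
    (fun i => m ⬝ᵥ conifoldRays p q i) = ![m 1 + q * m 2, m 1 + (q + 1) * m 2,
      p * m 0 + m 1 + m 2, p * m 0 + m 1] := by
  ext i
  fin_cases i <;> simp [conifoldRays, dotProduct, Fin.sum_univ_three] <;> ring

theorem rayPairing_injective {p q : ℕ} (hp : p ≠ 0) : Function.Injective (rayPairing p q) := by
  intro m n h
  have h (i) : (m : Fin 3 → ℤ) ⬝ᵥ conifoldRays p q i = (n : Fin 3 → ℤ) ⬝ᵥ conifoldRays p q i := by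
    rw [← rayPairing_apply, ← rayPairing_apply, h]
  have h := funext h
  rw [dotProduct_conifoldRays, dotProduct_conifoldRays] at h
  have h0 := congrFun h 0
  have h1 := congrFun h 1
  have h3 := congrFun h 3
  simp at h0 h1 h3
  have e2 : (m : Fin 3 → ℤ) 2 = (n : Fin 3 → ℤ) 2 := by linear_combination h1 - h0
  have e1 : (m : Fin 3 → ℤ) 1 = (n : Fin 3 → ℤ) 1 := by linear_combination h0 - q * e2
  have e0 : (p : ℤ) * (m : Fin 3 → ℤ) 0 = p * (n : Fin 3 → ℤ) 0 := by linear_combination h3 - e1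
  have e0 := mul_left_cancel₀ (by exact_mod_cast hp) e0
  ext i
  fin_cases i <;> assumption

/-- The equation reflects b₁ + b₃ = b₂ + b₄. The congruence says that the first coordinate of m,
found by solving the pairings, is an integer. -/
theorem range_rayPairing (p q : ℕ) : Set.range (rayPairing p q) = coxExponents p q := by
  ext s
  constructor
  · rintro ⟨m, rfl⟩
    have h (i) := (rayPairing_apply m i).trans (congrFun (dotProduct_conifoldRays p q m) i)
    have h0 := h 0
    have h1 := h 1
    have h2 := h 2
    have h3 := h 3
    simp at h0 h1 h2 h3
    refine ⟨?_, -(m : Fin 3 → ℤ) 0, ?_⟩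
    · zify
      linear_combination h0 + h2 - h1 - h3
    · linear_combination (1 + q) * h0 - q * h1 - h3
  · rintro ⟨h, k, hk⟩
    have h : (s 0 + s 2 : ℤ) = s 1 + s 3 := by exact_mod_cast h
    -- The pairings with b₁ and b₂ determine `m 2` and then `m 1`; the pairing with b₄ leaves p * `m
    -- 0` = -(p * k).
    let m : Fin 3 → ℤ := ![-k, s 0 - q * (s 1 - s 0), s 1 - s 0]
    have hm (i) : m ⬝ᵥ conifoldRays p q i = s i := by
      rw [congrFun (dotProduct_conifoldRays p q m) i]
      fin_cases i <;> simp [m]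
      · ring
      · linear_combination hk - h
      · linear_combination hk
    refine ⟨⟨m, mem_dualMonoid_latticeCone.2 fun i => by rw [hm]; positivity⟩, ?_⟩
    ext i
    zify
    rw [rayPairing_apply, hm]

/-- The embedding of `ℂ[S_σ]` into the Cox ring. -/
def toricCox (p q : ℕ) :
    AddMonoidAlgebra ℂ (dualMonoid (latticeCone (conifoldRays p q))) →ₐ[ℂ]
      MvPolynomial (Fin 4) ℂ :=
  AddMonoidAlgebra.mapDomainAlgHom ℂ ℂ (rayPairing p q)

theorem toricCox_injective {p q : ℕ} (hp : p ≠ 0) : Function.Injective (toricCox p q) :=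
  AddMonoidAlgebra.mapDomain_injective (rayPairing_injective hp)

theorem range_toricCox {p q : ℕ} (hp : p ≠ 0) :
    (toricCox p q).range = (invariantsCox p q).range := by
  ext f
  rw [mem_range_invariantsCox hp, toricCox, AddMonoidAlgebra.mem_range_mapDomainAlgHom_iff,
    range_rayPairing]
  rfl

/-- The functions on the quotient of the conifold form the semigroup algebra `ℂ[S_σ]`. -/
def invariantsEquiv {p q : ℕ} (hp : p ≠ 0) :
    conifoldInvariants p q ≃ₐ[ℂ] AddMonoidAlgebra ℂ (dualMonoid (latticeCone (conifoldRays p q))) :=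
  (AlgEquiv.ofInjective _ (invariantsCox_injective p q)).trans <|
    (Subalgebra.equivOfEq _ _ (range_toricCox hp).symm).trans
      (AlgEquiv.ofInjective _ (toricCox_injective hp)).symm

end ConifoldCox

/-! ### Normality and finite generation -/

section Normal

/-- A subring of a normal domain `B` which is closed under those quotients that exist in `B` is
normal. -/
theorem IsIntegrallyClosed.of_injective_of_quotients {R B : Type*} [CommRing R] [IsDomain R]
    [CommRing B] [IsDomain B] [IsIntegrallyClosed B] (j : R →+* B) (hj : Function.Injective j)
    (h : ∀ a b f, b ≠ 0 → j b * f = j a → f ∈ j.range) : IsIntegrallyClosed R := by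
  rw [isIntegrallyClosed_iff (FractionRing R)]
  intro x hx
  let Φ : FractionRing R →+* FractionRing B := IsFractionRing.map hj
  have hΦ (r : R) : Φ (algebraMap R _ r) = algebraMap B _ (j r) := IsLocalization.map_eq _ r
  obtain ⟨a, b, hb, rfl⟩ := IsFractionRing.div_surjective (A := R) x
  have hb0 : b ≠ 0 := nonZeroDivisors.ne_zero hb
  -- The integral equation is carried over to `B`; normality of `B` then makes the fraction an
  -- element f with j b * f = j a.
  have hΦx : IsIntegral B (Φ (algebraMap R _ a / algebraMap R _ b)) := by
    obtain ⟨P, hP, hP0⟩ := hx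
    refine ⟨P.map j, hP.map j, ?_⟩
    rw [Polynomial.eval₂_map]
    have := congrArg Φ hP0
    rw [Polynomial.hom_eval₂, map_zero] at this
    rwa [show (algebraMap B (FractionRing B)).comp j = Φ.comp (algebraMap R (FractionRing R)) from
      RingHom.ext fun r => (hΦ r).symm]
  obtain ⟨f, hf⟩ := IsIntegrallyClosed.isIntegral_iff.1 hΦx
  have hjb : algebraMap B (FractionRing B) (j b) ≠ 0 := by
    simpa using (map_ne_zero_iff j hj).2 hb0
  obtain ⟨c, rfl⟩ := h a b f hb0 <| by
    apply IsFractionRing.injective B (FractionRing B)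
    rw [map_mul, hf, map_div₀, hΦ, hΦ, mul_div_cancel₀ _ hjb]
  refine ⟨c, Φ.injective ?_⟩
  rw [hΦ, hf]

/-- Cancellation in the span of the monomials with exponents in a submonoid saturated by
differences. -/
theorem AddMonoidAlgebra.support_subset_of_mul {k M : Type*} [Field k] [AddCommMonoid M]
    [NoZeroDivisors (AddMonoidAlgebra k M)] {L : Set M}
    (hL : ∀ s ∈ L, ∀ t, s + t ∈ L ↔ t ∈ L) {b f : AddMonoidAlgebra k M} (hb0 : b ≠ 0)
    (hb : ↑b.coeff.support ⊆ L) (hbf : ↑(b * f).coeff.support ⊆ L) :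
    ↑f.coeff.support ⊆ L := by
  classical
  let f₁ : AddMonoidAlgebra k M := .ofCoeff (f.coeff.filter (· ∈ L))
  let f₂ : AddMonoidAlgebra k M := .ofCoeff (f.coeff.filter (· ∉ L))
  have hf : f₁ + f₂ = f := by
    ext1
    exact Finsupp.filter_add_filter_not _ _
  have h1 : ↑(b * f₁).coeff.support ⊆ L := by
    intro s hs
    obtain ⟨u, hu, v, hv, rfl⟩ :=
      Finset.mem_add.1 (AddMonoidAlgebra.support_coeff_mul_subset _ _ hs)
    exact (hL u (hb hu) v).2 (Finset.mem_filter.1 hv).2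
  have h2 (s) (hs : s ∈ (b * f₂).coeff.support) : s ∉ L := by
    obtain ⟨u, hu, v, hv, rfl⟩ :=
      Finset.mem_add.1 (AddMonoidAlgebra.support_coeff_mul_subset _ _ hs)
    exact fun h => (Finset.mem_filter.1 hv).2 ((hL u (hb hu) v).1 h)
  -- The support of b * f₂ avoids `L`, yet b * f₂ = b * f - b * f₁ is supported in `L`.
  have h3 : b * f₂ = 0 := by
    by_contra hne
    obtain ⟨s, hs⟩ := Finsupp.support_nonempty_iff.2
      (fun h => hne (AddMonoidAlgebra.coeff_eq_zero.1 h))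
    refine h2 s hs ?_
    have hsub : b * f₂ = b * f - b * f₁ := by rw [← hf]; ring
    rw [hsub, AddMonoidAlgebra.coeff_sub] at hs
    exact (Finset.mem_union.1 (Finsupp.support_sub hs)).elim (fun h => hbf h) (fun h => h1 h)
  have h4 : f₂ = 0 := (mul_eq_zero.1 h3).resolve_left hb0
  intro s hs
  rw [h4, add_zero] at hf
  rw [← hf] at hs
  exact (Finset.mem_filter.1 hs).2

variable {p q : ℕ}

instance isDomain_conifoldInvariants : IsDomain (conifoldInvariants p q) :=
  (invariantsCox_injective p q).isDomain (invariantsCox p q).toRingHom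

theorem add_mem_coxExponents_iff (s : Fin 4 →₀ ℕ) (hs : s ∈ coxExponents p q) (t : Fin 4 →₀ ℕ) :
    s + t ∈ coxExponents p q ↔ t ∈ coxExponents p q := by
  obtain ⟨h1, h2⟩ := hs
  refine and_congr ?_ ?_
  · simp only [Finsupp.add_apply]; omega
  · have : (((s + t) 0 : ℕ) - ((s + t) 3 : ℕ) + q * (((s + t) 0 : ℕ) - ((s + t) 1 : ℕ)) : ℤ) =
        (s 0 - s 3 + q * (s 0 - s 1)) + (t 0 - t 3 + q * (t 0 - t 1)) := by
      simp only [Finsupp.add_apply]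
      push_cast
      ring
    rw [this, dvd_add_right h2]

theorem isIntegrallyClosed_conifoldInvariants (hp : p ≠ 0) :
    IsIntegrallyClosed (conifoldInvariants p q) := by
  refine .of_injective_of_quotients (invariantsCox p q).toRingHom (invariantsCox_injective p q) ?_
  intro a b f hb h
  refine (mem_range_invariantsCox hp).2 ?_
  refine AddMonoidAlgebra.support_subset_of_mul add_mem_coxExponents_iff (b := invariantsCox p q b)
    ?_ ?_ ?_
  · exact (map_ne_zero_iff _ (invariantsCox_injective p q)).2 hb
  · exact (mem_range_invariantsCox hp).1 ⟨b, rfl⟩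
  · exact (mem_range_invariantsCox hp).1 ⟨a, h.symm⟩

instance finiteType_conifoldRing : Algebra.FiniteType ℂ ConifoldRing :=
  .of_surjective (Ideal.Quotient.mkₐ ℂ _) Ideal.Quotient.mk_surjective

/-- The p-th power of each coordinate is invariant, because its weight is a p-th root of unity. -/
theorem isIntegral_conifoldInvariants (hp : p ≠ 0) :
    Algebra.IsIntegral (conifoldInvariants p q) ConifoldRing := by
  suffices (integralClosure (conifoldInvariants p q) ConifoldRing).restrictScalars ℂ = ⊤ from
    ⟨fun x => (Subalgebra.mem_restrictScalars ℂ).1 (this ▸ Algebra.mem_top)⟩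
  rw [eq_top_iff, ← AlgHom.range_eq_top (Ideal.Quotient.mkₐ ℂ _) |>.2 Ideal.Quotient.mk_surjective,
    ← Algebra.map_top, ← MvPolynomial.adjoin_range_X, AlgHom.map_adjoin, Algebra.adjoin_le_iff]
  rintro _ ⟨_, ⟨i, rfl⟩, rfl⟩
  refine IsIntegral.of_pow (Nat.pos_of_ne_zero hp) ?_
  have hmem : (Ideal.Quotient.mk _ (MvPolynomial.X i) : ConifoldRing) ^ p ∈
      conifoldInvariants p q := by
    rw [mem_conifoldInvariants_iff]
    intro ζ hζ
    have hw : conifoldWeight q ζ i ^ p = 1 := by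
      have hζ : ζ ^ p = 1 := hζ
      fin_cases i <;> simp [conifoldWeight, hζ, ← pow_mul, mul_comm q p] <;> simp [pow_mul, hζ]
    rw [map_pow, conifoldSubst_mk_X, smul_pow, ← Units.val_pow_eq_pow_val, hw, Units.val_one,
      one_smul]
  exact isIntegral_algebraMap (x := (⟨_, hmem⟩ : conifoldInvariants p q))

/-- Artin–Tate: the conifold ring is of finite type over ℂ and finite over the invariants. -/
theorem finiteType_conifoldInvariants (hp : p ≠ 0) :
    Algebra.FiniteType ℂ (conifoldInvariants p q) := by
  have := isIntegral_conifoldInvariants (q := q) hp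
  have : Algebra.FiniteType (conifoldInvariants p q) ConifoldRing :=
    .of_restrictScalars_finiteType ℂ _ _
  have : Module.Finite (conifoldInvariants p q) ConifoldRing :=
    Algebra.IsIntegral.finite (R := conifoldInvariants p q) (A := ConifoldRing)
  exact ⟨fg_of_fg_of_fg ℂ (conifoldInvariants p q) ConifoldRing Algebra.FiniteType.out
    Module.Finite.fg_top Subtype.val_injective⟩

theorem isNormalVariety_spec (R : Type) [CommRing R] [Algebra ℂ R] [IsDomain R]
    [IsIntegrallyClosed R] [Algebra.FiniteType ℂ R] :
    IsNormalVariety ((Spec (.of R)).asOver (Spec (.of ℂ))) where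
  isIntegral := inferInstanceAs (IsIntegral (Spec (.of R)))
  isSeparated := inferInstanceAs (IsSeparated (Spec.map (CommRingCat.ofHom (algebraMap ℂ R))))
  locallyOfFiniteType :=
    locallyOfFiniteType_specOverSpec (R := CommRingCat.of ℂ) (A := CommRingCat.of R)
  quasiCompact := inferInstanceAs (QuasiCompact (Spec.map (CommRingCat.ofHom (algebraMap ℂ R))))
  isIntegrallyClosed x := by
    let x : PrimeSpectrum R := x
    have : IsLocalization.AtPrime ((Spec.structureSheaf R).presheaf.stalk x) x.asIdeal :=
      StructureSheaf.IsLocalization.to_stalk R x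
    exact isIntegrallyClosed_of_isLocalization
      (S := (Spec.structureSheaf R).presheaf.stalk x) x.asIdeal.primeCompl
      x.asIdeal.primeCompl_le_nonZeroDivisors

theorem isNormalVariety_conifoldQuotient (hp : p ≠ 0) :
    IsNormalVariety (conifoldQuotient p q) := by
  have := isIntegrallyClosed_conifoldInvariants (q := q) hp
  have := finiteType_conifoldInvariants (q := q) hp
  exact isNormalVariety_spec (conifoldInvariants p q)

end Normal

/-! ### The torus embedding and its action -/

section Torus

open CartesianMonoidalCategory MonoidalLeftAction Opposite

/-- `Spec` of a bialgebra homomorphism is a homomorphism of monoid schemes. -/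
theorem isMonHom_specMap_asOver {R A B : Type} [CommRing R] [CommRing A] [CommRing B]
    [Bialgebra R A] [Bialgebra R B] (f : A →ₐc[R] B) :
    IsMonHom ((Spec.map (CommRingCat.ofHom (f : A →ₐ[R] B).toRingHom)).asOver (Spec (.of R)) :
      (Spec (.of B)).asOver (Spec (.of R)) ⟶ (Spec (.of A)).asOver (Spec (.of R))) := by
  exact ((bialgSpec (CommRingCat.of R)).map (op (CommBialgCat.ofHom f))).isMonHom_hom

instance affineToricMon {n : ℕ} (σ : PointedCone ℝ (Fin n → ℝ)) : MonObj (affineToric σ) :=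
  instMonObjSpecAsOverSpec (R := CommRingCat.of ℂ)
    (A := CommRingCat.of (AddMonoidAlgebra ℂ (dualMonoid σ)))

instance isMonHom_affineToricEmb {n : ℕ} (σ : PointedCone ℝ (Fin n → ℝ)) :
    IsMonHom (affineToricEmb σ) :=
  isMonHom_specMap_asOver (AddMonoidAlgebra.mapDomainBialgHom ℂ (dualMonoid σ).subtype)

/-- Evaluating the trivial action at the unit of X shows that g followed by f is the unit; the
monomorphism f is then cancelled. -/
theorem scalarRestriction_regular_effective {C : Type*} [Category* C] [CartesianMonoidalCategory C]
    {T X S : C} [MonObj T] [MonObj X] (f : T ⟶ X) [IsMonHom f] [Mono f] (g : S ⟶ T)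
    (h : (g ▷ X) ≫ (f ▷ X) ≫ μ[X] = snd S X) : g = toUnit S ≫ η[T] := by
  have h1 := congr(lift (𝟙 S) (toUnit S ≫ η[X]) ≫ $h)
  rw [← cancel_mono f]
  simpa using h1

/-- A monoid scheme containing the torus as an open submonoid is a toric variety. -/
def TorusEmbedding.ofMonHom {n : ℕ} {X : Over (Spec (CommRingCat.of ℂ))} [MonObj X]
    (f : algTorus n ⟶ X) [IsMonHom f] (hf : IsOpenImmersion f.left) : TorusEmbedding n X where
  emb := f
  isOpenImmersion := hf
  action := letI := ModObj.regular X; Mod.scalarRestriction f X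
  equivariant := by
    change (algTorus n ◁ f) ≫ (f ▷ X) ≫ μ[X] = _
    rw [IsMonHom.mul_hom, tensorHom_def', Category.assoc]
  effective S g h := by
    have : Mono f.left := inferInstance
    have : Mono f := Over.mono_of_mono_left f
    exact scalarRestriction_regular_effective f g h

/-- Torus embeddings are transported along isomorphisms of the ambient monoid scheme. -/
theorem exists_torusEmbedding_of_iso {n : ℕ} {X Y : Over (Spec (CommRingCat.of ℂ))} [MonObj Y]
    (f : algTorus n ⟶ Y) [IsMonHom f] (hf : IsOpenImmersion f.left) (e : X ≅ Y) :
    ∃ j : TorusEmbedding n X, j.emb ≫ e.hom = f := by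
  let : MonObj X := MonObj.ofIso e.symm
  have : IsMonHom (f ≫ e.inv) :=
    have : IsMonHom e.inv := isMonHom_ofIso e.symm
    inferInstance
  refine ⟨TorusEmbedding.ofMonHom (f ≫ e.inv) ?_, ?_⟩
  · rw [Over.comp_left]
    have : IsIso e.inv.left := inferInstanceAs (IsIso ((Over.forget _).map e.inv))
    infer_instance
  · simp [TorusEmbedding.ofMonHom]


/-- If `σ^∨` has an interior lattice point, then `T ⟶ U_σ` is an open immersion. -/
theorem isOpenImmersion_affineToricEmb {n : ℕ} (σ : PointedCone ℝ (Fin n → ℝ)) (m : dualMonoid σ)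
    (hm : ∀ k : Fin n → ℤ, ∃ N : ℕ, k + N • (m : Fin n → ℤ) ∈ dualMonoid σ) :
    IsOpenImmersion (affineToricEmb σ).left := by
  let φ := AddMonoidAlgebra.mapDomainAlgHom ℂ ℂ (dualMonoid σ).subtype
  let := φ.toRingHom.toAlgebra
  have hφ (a : AddMonoidAlgebra ℂ (dualMonoid σ)) :
      algebraMap _ (AddMonoidAlgebra ℂ (Fin n → ℤ)) a = φ a := rfl
  have hs (a : dualMonoid σ) (c : ℂ) : φ (.single a c) = .single (a : Fin n → ℤ) c := by
    simp [φ]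
  have hinj : Function.Injective φ :=
    AddMonoidAlgebra.mapDomain_injective Subtype.val_injective
  -- ℂ[ℤⁿ] arises from ℂ[S_σ] by inverting the single character χᵐ: by `hm`, a power of it clears
  -- the denominator of any monomial.
  have : IsLocalization.Away (AddMonoidAlgebra.single m (1 : ℂ))
      (AddMonoidAlgebra ℂ (Fin n → ℤ)) := by
    refine IsLocalization.Away.mk _ ?_ ?_ ?_
    · rw [hφ, hs]
      refine .of_mul_eq_one (AddMonoidAlgebra.single (-(m : Fin n → ℤ)) 1) ?_
      simp [AddMonoidAlgebra.single_mul_single, AddMonoidAlgebra.one_def]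
    · intro f
      simp only [hφ]
      induction f using AddMonoidAlgebra.induction_linear with
      | zero => exact ⟨0, 0, by simp⟩
      | add f g hf hg =>
        obtain ⟨k, a, ha⟩ := hf
        obtain ⟨l, b, hb⟩ := hg
        refine ⟨k + l, a * (.single m 1) ^ l + b * (.single m 1) ^ k, ?_⟩
        simp only [map_add, map_mul, ← ha, ← hb, map_pow]
        ring
      | single k c =>
        obtain ⟨N, hN⟩ := hm k
        refine ⟨N, .single ⟨_, hN⟩ c, ?_⟩
        simp [hs, AddMonoidAlgebra.single_pow, AddMonoidAlgebra.single_mul_single]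
    · intro a b hab
      exact ⟨0, by rw [hinj hab]⟩
  exact IsOpenImmersion.of_isLocalization (AddMonoidAlgebra.single m (1 : ℂ))

end Torus

/-! ### Euler derivations of monoid algebras -/

section Euler

/-- The linear map underlying `AddMonoidAlgebra.eulerDerivation`. -/
def AddMonoidAlgebra.eulerLinearMap {k M : Type*} [CommRing k] [AddCommMonoid M] (κ : M →+ k) :
    AddMonoidAlgebra k M →ₗ[k] AddMonoidAlgebra k M :=
  (Finsupp.lsum k fun m => κ m • (AddMonoidAlgebra.coeffLinearEquiv k).symm.toLinearMap ∘ₗ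
    Finsupp.lsingle m) ∘ₗ (AddMonoidAlgebra.coeffLinearEquiv k).toLinearMap

theorem AddMonoidAlgebra.eulerLinearMap_single {k M : Type*} [CommRing k] [AddCommMonoid M]
    (κ : M →+ k) (m : M) (c : k) :
    eulerLinearMap κ (.single m c) = .single m (κ m * c) := by
  simp [eulerLinearMap]

/-- The derivation `χᵐ ↦ κ(m) χᵐ` of a monoid algebra. -/
def AddMonoidAlgebra.eulerDerivation {k M : Type*} [CommRing k] [AddCommMonoid M] (κ : M →+ k) :
    Derivation k (AddMonoidAlgebra k M) (AddMonoidAlgebra k M) :=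
  Derivation.mk' (eulerLinearMap κ) <| by
    intro a b
    simp only [smul_eq_mul]
    induction a using AddMonoidAlgebra.induction_linear with
    | zero => simp
    | add f g hf hg => rw [add_mul, map_add, hf, hg, map_add]; ring
    | single m c =>
      induction b using AddMonoidAlgebra.induction_linear with
      | zero => simp
      | add f g hf hg => rw [mul_add, map_add, hf, hg, map_add]; ring
      | single n d =>
        simp only [AddMonoidAlgebra.single_mul_single, eulerLinearMap_single, add_comm n m,
          ← AddMonoidAlgebra.single_add, map_add]
        congr 1
        ring

theorem AddMonoidAlgebra.eulerDerivation_single {k M : Type*} [CommRing k] [AddCommMonoid M]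
    (κ : M →+ k) (m : M) (c : k) :
    eulerDerivation κ (.single m c) = .single m (κ m * c) :=
  eulerLinearMap_single κ m c

end Euler

/-! ### Differentials of a semigroup ring through logarithmic forms -/

section LogForms

/-- As `S` need not contain negatives, the negative parts of the coordinates are moved to the other
side before g is applied. -/
theorem AddMonoidHom.eq_sum_of_single_mem {n : ℕ} {S : AddSubmonoid (Fin n → ℤ)}
    (hS : ∀ i, Pi.single i 1 ∈ S) {V : Type*} [AddCommGroup V] (g : S →+ V) (a : S) :
    g a = ∑ i, (a : Fin n → ℤ) i • g ⟨_, hS i⟩ := by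
  have hi (z : ℤ) : z = z⁺.toNat - z⁻.toNat := by
    rw [Int.toNat_of_nonneg (posPart_nonneg z), Int.toNat_of_nonneg (negPart_nonneg z),
      posPart_sub_negPart]
  have h : a + ∑ i, ((a : Fin n → ℤ) i)⁻.toNat • (⟨_, hS i⟩ : S) =
      ∑ i, ((a : Fin n → ℤ) i)⁺.toNat • (⟨_, hS i⟩ : S) := by
    ext j
    simp only [AddSubmonoid.coe_add, AddSubmonoid.coe_finsetSum, AddSubmonoidClass.coe_nsmul,
      Pi.add_apply, Finset.sum_apply, Pi.smul_apply, Pi.single_apply]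
    simp only [nsmul_eq_mul, mul_ite, _root_.mul_one, mul_zero, Finset.sum_ite_eq,
      Finset.mem_univ, if_true]
    linarith [hi ((a : Fin n → ℤ) j)]
  have := congrArg g h
  simp only [map_add, map_sum, map_nsmul] at this
  rw [← eq_sub_iff_add_eq, ← Finset.sum_sub_distrib] at this
  rw [this]
  refine Finset.sum_congr rfl fun i _ => ?_
  rw [← natCast_zsmul, ← natCast_zsmul, ← sub_smul, ← hi]

/-- `R` is embedded in `ℂ[ℤⁿ]` as the algebra of the semigroup `S`. -/
structure IsSemigroupRing {n : ℕ} (R : Type) [CommRing R] (S : AddSubmonoid (Fin n → ℤ))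
    [Algebra R (AddMonoidAlgebra ℂ (Fin n → ℤ))] : Prop where
  injective : Function.Injective (algebraMap R (AddMonoidAlgebra ℂ (Fin n → ℤ)))
  mem_range_iff : ∀ f : AddMonoidAlgebra ℂ (Fin n → ℤ),
    f ∈ (algebraMap R (AddMonoidAlgebra ℂ (Fin n → ℤ))).range ↔ ∀ m ∈ f.coeff.support, m ∈ S

namespace IsSemigroupRing

variable {n : ℕ} {R : Type} [CommRing R] {S : AddSubmonoid (Fin n → ℤ)}
  [Algebra R (AddMonoidAlgebra ℂ (Fin n → ℤ))]

theorem exists_character (h : IsSemigroupRing R S) (a : S) :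
    ∃ r : R, algebraMap R (AddMonoidAlgebra ℂ (Fin n → ℤ)) r = .single (a : Fin n → ℤ) 1 := by
  refine (h.mem_range_iff _).2 fun m hm => ?_
  rw [Finset.mem_singleton.1 (Finsupp.support_single_subset hm)]
  exact a.2

/-- The monomial `χᵃ` in `R`. -/
def character (h : IsSemigroupRing R S) (a : S) : R := (h.exists_character a).choose

theorem algebraMap_character (h : IsSemigroupRing R S) (a : S) :
    algebraMap R (AddMonoidAlgebra ℂ (Fin n → ℤ)) (h.character a) = .single (a : Fin n → ℤ) 1 :=
  (h.exists_character a).choose_spec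

theorem character_add (h : IsSemigroupRing R S) (a b : S) :
    h.character (a + b) = h.character a * h.character b := by
  apply h.injective
  simp [algebraMap_character, AddMonoidAlgebra.single_mul_single]

variable [Algebra ℂ R] [IsScalarTower ℂ R (AddMonoidAlgebra ℂ (Fin n → ℤ))]

theorem span_character (h : IsSemigroupRing R S) :
    Submodule.span ℂ (Set.range h.character) = ⊤ := by
  rw [eq_top_iff]
  rintro r -
  have hs := (h.mem_range_iff _).1 ⟨r, rfl⟩
  set f := algebraMap R (AddMonoidAlgebra ℂ (Fin n → ℤ)) r with hf
  have hr : r = ∑ s : f.coeff.support, f.coeff s • h.character ⟨s, hs s s.2⟩ := by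
    apply h.injective
    rw [map_sum, ← hf]
    conv_lhs => rw [← f.sum_coeff_single, Finsupp.sum, ← Finset.sum_coe_sort]
    refine Finset.sum_congr rfl fun s _ => ?_
    rw [Algebra.smul_def, map_mul, ← IsScalarTower.algebraMap_apply, algebraMap_character,
      ← Algebra.smul_def]
    simp
  rw [hr]
  exact Submodule.sum_mem _ fun s _ => Submodule.smul_mem _ _ (Submodule.subset_span ⟨_, rfl⟩)

theorem span_D_character (h : IsSemigroupRing R S) :
    Submodule.span R (Set.range fun a => KaehlerDifferential.D ℂ R (h.character a)) = ⊤ := by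
  rw [eq_top_iff, ← KaehlerDifferential.span_range_derivation, Submodule.span_le]
  rintro _ ⟨r, rfl⟩
  have hr : r ∈ Submodule.span ℂ (Set.range h.character) := by rw [span_character]; trivial
  induction hr using Submodule.span_induction with
  | mem r hr =>
    obtain ⟨a, rfl⟩ := hr
    exact Submodule.subset_span ⟨a, rfl⟩
  | zero => rw [map_zero]; exact Submodule.zero_mem _
  | add r s _ _ hr hs => rw [map_add]; exact Submodule.add_mem _ hr hs
  | smul c r _ hr =>
    rw [Derivation.map_smul, ← algebraMap_smul R]
    exact Submodule.smul_mem _ _ hr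

/-- The linear form `dχᵃ ↦ aᵢ χᵃ` on the differentials. -/
def eulerForm (R : Type) [CommRing R] [Algebra R (AddMonoidAlgebra ℂ (Fin n → ℤ))] [Algebra ℂ R]
    [IsScalarTower ℂ R (AddMonoidAlgebra ℂ (Fin n → ℤ))] (i : Fin n) :
    Ω[R⁄ℂ] →ₗ[R] AddMonoidAlgebra ℂ (Fin n → ℤ) :=
  ((AddMonoidAlgebra.eulerDerivation ((Int.castAddHom ℂ).comp (Pi.evalAddMonoidHom (fun _ => ℤ) i))
    ).compAlgebraMap R).liftKaehlerDifferential

theorem eulerForm_D_character (h : IsSemigroupRing R S) (i : Fin n) (a : S) :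
    eulerForm R i (KaehlerDifferential.D ℂ R (h.character a)) =
      .single (a : Fin n → ℤ) (((a : Fin n → ℤ) i : ℤ) : ℂ) := by
  rw [eulerForm, Derivation.liftKaehlerDifferential_comp_D]
  change AddMonoidAlgebra.eulerDerivation _ (algebraMap R _ _) = _
  rw [algebraMap_character, AddMonoidAlgebra.eulerDerivation_single]
  simp

/-- Linear forms with values in `ℂ[ℤⁿ]` are combinations of the forms `dχᵃ ↦ aᵢ χᵃ`. -/
theorem linearMap_eq_sum_eulerForm (h : IsSemigroupRing R S) (hS : ∀ i, Pi.single i 1 ∈ S)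
    (g : Ω[R⁄ℂ] →ₗ[R] AddMonoidAlgebra ℂ (Fin n → ℤ)) (ω : Ω[R⁄ℂ]) :
    g ω = ∑ i, eulerForm R i ω * (.single (-Pi.single i 1) 1 *
      g (KaehlerDifferential.D ℂ R (h.character ⟨_, hS i⟩))) := by
  -- By the Leibniz rule the logarithmic derivative χ^{-a} g(dχ^a) is additive in a, hence
  -- determined by its values on the standard basis.
  let G : S →+ AddMonoidAlgebra ℂ (Fin n → ℤ) := AddMonoidHom.mk'
    (fun a => .single (-(a : Fin n → ℤ)) 1 * g (KaehlerDifferential.D ℂ R (h.character a))) <| by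
      intro a b
      have e1 : AddMonoidAlgebra.single (-((a + b : S) : Fin n → ℤ)) (1 : ℂ) *
          .single (a : Fin n → ℤ) 1 = .single (-(b : Fin n → ℤ)) 1 := by
        simp [AddMonoidAlgebra.single_mul_single]
      have e2 : AddMonoidAlgebra.single (-((a + b : S) : Fin n → ℤ)) (1 : ℂ) *
          .single (b : Fin n → ℤ) 1 = .single (-(a : Fin n → ℤ)) 1 := by
        simp [AddMonoidAlgebra.single_mul_single]
      rw [character_add, Derivation.leibniz, map_add, map_smul, map_smul, Algebra.smul_def,
        Algebra.smul_def, algebraMap_character, algebraMap_character, mul_add,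
        ← _root_.mul_assoc, ← _root_.mul_assoc, e1, e2, add_comm]
  have hω : ω ∈ Submodule.span R
      (Set.range fun a => KaehlerDifferential.D ℂ R (h.character a)) := by
    rw [span_D_character]; trivial
  induction hω using Submodule.span_induction with
  | mem ω hω =>
    obtain ⟨a, rfl⟩ := hω
    have hG := G.eq_sum_of_single_mem hS a
    have hg : g (KaehlerDifferential.D ℂ R (h.character a)) = .single (a : Fin n → ℤ) 1 * G a := by
      simp [G, ← _root_.mul_assoc, AddMonoidAlgebra.single_mul_single,
        ← AddMonoidAlgebra.one_def]
    rw [hg, hG, Finset.mul_sum]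
    refine Finset.sum_congr rfl fun i _ => ?_
    rw [eulerForm_D_character, mul_smul_comm, ← Int.cast_smul_eq_zsmul ℂ, ← smul_mul_assoc]
    simp [G]
  | zero => simp
  | add x y _ _ hx hy => simp only [map_add, hx, hy, add_mul, Finset.sum_add_distrib]
  | smul r x _ hx => simp only [map_smul, hx, Finset.smul_sum, smul_mul_assoc]

/-- The alternating form `(dχᵃ¹, …, dχᵃⁿ) ↦ det(a₁, …, aₙ) χᵃ¹⁺⋯⁺ᵃⁿ` with values in `ℂ[ℤⁿ]`. -/
def topForm (R : Type) [CommRing R] [Algebra R (AddMonoidAlgebra ℂ (Fin n → ℤ))] [Algebra ℂ R]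
    [IsScalarTower ℂ R (AddMonoidAlgebra ℂ (Fin n → ℤ))] :
    Ω[R⁄ℂ] [⋀^Fin n]→ₗ[R] AddMonoidAlgebra ℂ (Fin n → ℤ) :=
  AlternatingMap.compLinearMap
    { Matrix.detRowAlternating.toMultilinearMap.restrictScalars R with
      map_eq_zero_of_eq' := Matrix.detRowAlternating.map_eq_zero_of_eq' }
    (LinearMap.pi (eulerForm R))

theorem topForm_apply (v : Fin n → Ω[R⁄ℂ]) :
    topForm R v = Matrix.det (.of fun i j => eulerForm R j (v i)) := rfl

/-- Row i of the matrix is the character of aᵢ times the integer vector aᵢ, so the characters factor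
out of the determinant. -/
theorem topForm_D_character (h : IsSemigroupRing R S) (a : Fin n → S) :
    topForm R (fun i => KaehlerDifferential.D ℂ R (h.character (a i))) =
      .single (∑ i, (a i : Fin n → ℤ))
        ((Matrix.det (.of fun i j => (a i : Fin n → ℤ) j) : ℤ) : ℂ) := by
  have : (Matrix.of fun i j => eulerForm R j (KaehlerDifferential.D ℂ R (h.character (a i)))) =
      Matrix.of fun i j => AddMonoidAlgebra.single (a i : Fin n → ℤ) (1 : ℂ) *
        (algebraMap ℤ (AddMonoidAlgebra ℂ (Fin n → ℤ))).mapMatrix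
          (.of fun i j => (a i : Fin n → ℤ) j) i j := by
    ext1 i j
    simp [eulerForm_D_character, AddMonoidAlgebra.single_mul_single]
  rw [topForm_apply, this, Matrix.det_mul_column, ← RingHom.map_det, AddMonoidAlgebra.prod_single]
  simp [AddMonoidAlgebra.intCast_def, AddMonoidAlgebra.single_mul_single]

end IsSemigroupRing

end LogForms

/-! ### Top forms and the reflexive hull of ⋀³Ω -/

section TopForms

namespace IsSemigroupRing

variable {R : Type} [CommRing R] {S : AddSubmonoid (Fin 3 → ℤ)}
  [Algebra R (AddMonoidAlgebra ℂ (Fin 3 → ℤ))] [Algebra ℂ R]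
  [IsScalarTower ℂ R (AddMonoidAlgebra ℂ (Fin 3 → ℤ))]

/-- Alternating `3`-forms with values in `ℂ[ℤ³]` are multiples of the standard one. -/
theorem alternatingMap_eq_topForm (h : IsSemigroupRing R S) (hS : ∀ i, Pi.single i 1 ∈ S)
    (L : Ω[R⁄ℂ] [⋀^Fin 3]→ₗ[R] AddMonoidAlgebra ℂ (Fin 3 → ℤ)) :
    ∃ F, ∀ v, L v = F * topForm R v := by
  let c (i : Fin 3) : Ω[R⁄ℂ] := KaehlerDifferential.D ℂ R (h.character ⟨_, hS i⟩)
  let τ (i : Fin 3) : AddMonoidAlgebra ℂ (Fin 3 → ℤ) := .single (-Pi.single i 1) 1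
  have h0 (x y z) : L ![x, y, z] = ∑ i, eulerForm R i x * (τ i * L ![c i, y, z]) := by
    have hu (w) : Function.update ![0, y, z] 0 w = ![w, y, z] := by
      ext i; fin_cases i <;> rfl
    have := h.linearMap_eq_sum_eulerForm hS (L.toMultilinearMap.toLinearMap ![0, y, z] 0) x
    simp only [MultilinearMap.toLinearMap_apply, hu] at this
    exact this
  have h1 (x y z) : L ![x, y, z] = ∑ i, eulerForm R i y * (τ i * L ![x, c i, z]) := by
    have hu (w) : Function.update ![x, 0, z] 1 w = ![x, w, z] := by
      ext i; fin_cases i <;> rfl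
    have := h.linearMap_eq_sum_eulerForm hS (L.toMultilinearMap.toLinearMap ![x, 0, z] 1) y
    simp only [MultilinearMap.toLinearMap_apply, hu] at this
    exact this
  have h2 (x y z) : L ![x, y, z] = ∑ i, eulerForm R i z * (τ i * L ![x, y, c i]) := by
    have hu (w) : Function.update ![x, y, 0] 2 w = ![x, y, w] := by
      ext i; fin_cases i <;> rfl
    have := h.linearMap_eq_sum_eulerForm hS (L.toMultilinearMap.toLinearMap ![x, y, 0] 2) z
    simp only [MultilinearMap.toLinearMap_apply, hu] at this
    exact this
  have z01 (x z) : L ![x, x, z] = 0 := L.map_eq_zero_of_eq _ (i := 0) (j := 1) rfl (by decide)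
  have z02 (x z) : L ![x, z, x] = 0 := L.map_eq_zero_of_eq _ (i := 0) (j := 2) rfl (by decide)
  have z12 (x z) : L ![z, x, x] = 0 := L.map_eq_zero_of_eq _ (i := 1) (j := 2) rfl (by decide)
  have s01 (x y z) : L ![y, x, z] = - L ![x, y, z] := by
    rw [← L.map_swap _ (i := 0) (j := 1) (by decide)]
    congr 1; ext i; fin_cases i <;> rfl
  have s12 (x y z) : L ![x, z, y] = - L ![x, y, z] := by
    rw [← L.map_swap _ (i := 1) (j := 2) (by decide)]
    congr 1; ext i; fin_cases i <;> rfl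
  refine ⟨τ 0 * τ 1 * τ 2 * L ![c 0, c 1, c 2], fun v => ?_⟩
  have hv : v = ![v 0, v 1, v 2] := by ext i; fin_cases i <;> rfl
  have e1 : L ![c 1, c 0, c 2] = - L ![c 0, c 1, c 2] := s01 _ _ _
  have e2 : L ![c 0, c 2, c 1] = - L ![c 0, c 1, c 2] := s12 _ _ _
  have e3 : L ![c 1, c 2, c 0] = L ![c 0, c 1, c 2] := by rw [s12, e1, neg_neg]
  have e4 : L ![c 2, c 0, c 1] = L ![c 0, c 1, c 2] := by rw [s01, e2, neg_neg]
  have e5 : L ![c 2, c 1, c 0] = - L ![c 0, c 1, c 2] := by rw [s01, e3]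
  -- Of these 27 terms, alternation leaves the six with distinct indices, which assemble to the
  -- determinant.
  have hexp (x y z) : L ![x, y, z] = ∑ i, ∑ j, ∑ k, eulerForm R i x * (τ i *
      (eulerForm R j y * (τ j * (eulerForm R k z * (τ k * L ![c i, c j, c k]))))) := by
    rw [h0]
    refine Finset.sum_congr rfl fun i _ => ?_
    rw [h1 (c i), Finset.mul_sum, Finset.mul_sum]
    refine Finset.sum_congr rfl fun j _ => ?_
    rw [h2 (c i) (c j)]
    simp only [Finset.mul_sum]
  rw [topForm_apply, Matrix.det_fin_three, hv, hexp]
  simp only [Fin.sum_univ_three, z01, z02, z12, e1, e2, e3, e4, e5,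
    mul_zero, add_zero, zero_add, Matrix.of_apply, Matrix.cons_val]
  ring

/-- The differentials of characters span Ω over `R`, so their wedge products span ⋀³Ω. -/
theorem exteriorPower_linearMap_ext_character (h : IsSemigroupRing R S) {N : Type*}
    [AddCommGroup N] [Module R N] (P : Submodule R N) (f : ⋀[R]^3 Ω[R⁄ℂ] →ₗ[R] N)
    (hf : ∀ a : Fin 3 → S, f (exteriorPower.ιMulti R 3
      fun i => KaehlerDifferential.D ℂ R (h.character (a i))) ∈ P) (x) : f x ∈ P := by
  have hx : x ∈ Submodule.span R (exteriorPower.ιMulti R 3 '' {a | Set.range a ⊆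
      Set.range fun a => KaehlerDifferential.D ℂ R (h.character a)}) := by
    rw [exteriorPower.ιMulti_span_of_span _ _ _ h.span_D_character]; trivial
  induction hx using Submodule.span_induction with
  | mem x hx =>
    obtain ⟨v, hv, rfl⟩ := hx
    choose a ha using fun i => hv ⟨i, rfl⟩
    rw [← funext ha]
    exact hf a
  | zero => rw [map_zero]; exact zero_mem _
  | add x y _ _ hx hy => rw [map_add]; exact add_mem hx hy
  | smul r x _ hx => rw [map_smul]; exact P.smul_mem _ hx

/-- If `k + m ∈ S` is equivalent to `k + a₀ + a₁ + a₂ ∈ S` for all linearly independent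
`a₀, a₁, a₂ ∈ S`, then the reflexive hull of the top differential forms is trivial. -/
theorem nonempty_dual_dual_exteriorPower_equiv (h : IsSemigroupRing R S)
    (hS : ∀ i, Pi.single i 1 ∈ S) (m : Fin 3 → ℤ)
    (hm : ∀ a : Fin 3 → S, Matrix.det (.of fun i j => (a i : Fin 3 → ℤ) j) ≠ 0 →
      ∑ i, (a i : Fin 3 → ℤ) - m ∈ S)
    (hm' : ∀ k : Fin 3 → ℤ, (∀ a : Fin 3 → S,
      Matrix.det (.of fun i j => (a i : Fin 3 → ℤ) j) ≠ 0 → k + ∑ i, (a i : Fin 3 → ℤ) ∈ S) →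
      k + m ∈ S) :
    Nonempty (Module.Dual R (Module.Dual R (⋀[R]^3 Ω[R⁄ℂ])) ≃ₗ[R] R) := by
  let T := AddMonoidAlgebra ℂ (Fin 3 → ℤ)
  let inc : R →ₗ[R] T := Algebra.linearMap R T
  have hinc : Function.Injective inc := h.injective
  have hsingle (k : Fin 3 → ℤ) (c : ℂ) (hk : c ≠ 0 → k ∈ S) :
      (AddMonoidAlgebra.single k c : T) ∈ LinearMap.range inc := by
    refine (h.mem_range_iff _).2 fun s hs => ?_
    have hc : c ≠ 0 := by rintro rfl; simp at hs
    rw [Finset.mem_singleton.1 (Finsupp.support_single_subset hs)]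
    exact hk hc
  let W : ⋀[R]^3 Ω[R⁄ℂ] →ₗ[R] T := exteriorPower.alternatingMapLinearEquiv (topForm R)
  have hW (v) : W (exteriorPower.ιMulti R 3 v) = topForm R v :=
    exteriorPower.alternatingMapLinearEquiv_apply_ιMulti _ _
  let W' : ⋀[R]^3 Ω[R⁄ℂ] →ₗ[R] T := LinearMap.mulLeft R (AddMonoidAlgebra.single (-m) 1 : T) ∘ₗ W
  have hW' (x) : W' x ∈ LinearMap.range inc := by
    refine h.exteriorPower_linearMap_ext_character _ W' (fun a => ?_) x
    change _ * W _ ∈ _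
    rw [hW, topForm_D_character, AddMonoidAlgebra.single_mul_single]
    refine hsingle _ _ fun hc => ?_
    rw [neg_add_eq_sub]
    refine hm a fun hd => hc ?_
    rw [hd]; simp
  -- The candidate generator of the dual: χ^{-m} times the standard form, which is `R`-valued by
  -- `hm`.
  let D : ⋀[R]^3 Ω[R⁄ℂ] →ₗ[R] R :=
    (LinearEquiv.ofInjective inc hinc).symm.toLinearMap ∘ₗ W'.codRestrict _ hW'
  have hD (x) : inc (D x) = .single (-m) 1 * W x :=
    congrArg Subtype.val ((LinearEquiv.ofInjective inc hinc).apply_symm_apply ⟨W' x, hW' x⟩)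
  let E : R →ₗ[R] Module.Dual R (⋀[R]^3 Ω[R⁄ℂ]) := LinearMap.toSpanSingleton R _ D
  have hE (r x) : inc (E r x) = inc r * (.single (-m) 1 * W x) := by
    rw [← hD]; exact map_mul (algebraMap R T) _ _
  have hbij : Function.Bijective E := by
    constructor
    · rw [injective_iff_map_eq_zero]
      intro r hr
      -- On the standard basis the determinant is 1, so the standard form takes a unit of ℂ[ℤ³] as
      -- value, and r must vanish.
      let e (i : Fin 3) : S := ⟨_, hS i⟩
      have := hE r (exteriorPower.ιMulti R 3 fun i => KaehlerDifferential.D ℂ R (h.character (e i)))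
      have hdet : Matrix.det (.of fun i j => (e i : Fin 3 → ℤ) j) = 1 := by
        rw [← Matrix.det_one (n := Fin 3)]
        congr 1
        ext i j
        simp [e, Matrix.one_apply, Pi.single_apply, eq_comm]
      rw [hr, hW, topForm_D_character, hdet, AddMonoidAlgebra.single_mul_single] at this
      have hz : inc r = 0 := by
        have h2 := congr($this * (AddMonoidAlgebra.single (-(-m + ∑ i, (e i : Fin 3 → ℤ))) 1 : T))
        rw [_root_.mul_assoc, AddMonoidAlgebra.single_mul_single] at h2
        simpa [← AddMonoidAlgebra.one_def] using h2.symm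
      exact hinc (hz.trans (map_zero inc).symm)
    · intro G
      obtain ⟨F, hF⟩ := h.alternatingMap_eq_topForm hS
        (inc.compAlternatingMap (exteriorPower.alternatingMapLinearEquiv.symm G))
      have hF (x) : inc (G x) = F * W x := by
        have : inc ∘ₗ G = LinearMap.mulLeft R F ∘ₗ W := by
          apply exteriorPower.linearMap_ext
          refine AlternatingMap.ext fun v => ?_
          simpa [hW] using hF v
        exact LinearMap.congr_fun this x
      -- Evaluating G on independent triples shows that each exponent k of F satisfies the
      -- assumption of `hm'`.
      have hmem : F * .single m 1 ∈ LinearMap.range inc := by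
        refine (h.mem_range_iff _).2 fun s hs => ?_
        rw [AddMonoidAlgebra.support_coeff_mul_single _ _ (by simp)] at hs
        obtain ⟨k, hk, rfl⟩ := Finset.mem_map.1 hs
        refine hm' k fun a ha => ?_
        have h3 := hF (exteriorPower.ιMulti R 3
          fun i => KaehlerDifferential.D ℂ R (h.character (a i)))
        rw [hW, topForm_D_character] at h3
        refine (h.mem_range_iff _).1 ⟨_, h3⟩ _ ?_
        rw [AddMonoidAlgebra.support_coeff_mul_single _ _ (fun y => by simp [ha])]
        exact Finset.mem_map.2 ⟨k, hk, rfl⟩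
      obtain ⟨r, hr⟩ := hmem
      refine ⟨r, LinearMap.ext fun x => hinc ?_⟩
      rw [hE, hr, hF, _root_.mul_assoc, ← _root_.mul_assoc (AddMonoidAlgebra.single m 1),
        AddMonoidAlgebra.single_mul_single]
      simp [← AddMonoidAlgebra.one_def]
  let e := LinearEquiv.ofBijective E hbij
  exact ⟨e.dualMap.trans (LinearMap.ringLmapEquivSelf R R R)⟩

end IsSemigroupRing

end TopForms

/-! ### The dual cone of σ, the canonical sheaf and the toric isomorphism -/

section Main

variable {p q : ℕ}

theorem mem_dualMonoid_conifoldCone {m : Fin 3 → ℤ} :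
    m ∈ dualMonoid (latticeCone (conifoldRays p q)) ↔ 0 ≤ m 1 + q * m 2 ∧
      0 ≤ m 1 + (q + 1) * m 2 ∧ 0 ≤ p * m 0 + m 1 + m 2 ∧ 0 ≤ p * m 0 + m 1 := by
  rw [mem_dualMonoid_latticeCone]
  have h := congrFun (dotProduct_conifoldRays p q m)
  simp only [h, Fin.forall_fin_succ]
  simp

theorem single_mem_dualMonoid_conifoldCone (i : Fin 3) :
    Pi.single i 1 ∈ dualMonoid (latticeCone (conifoldRays p q)) := by
  rw [mem_dualMonoid_conifoldCone]
  fin_cases i <;> simp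
  positivity

/-- Three independent vectors cannot all vanish on bᵢ. Their pairings with bᵢ are nonnegative
integers, so the sum is at least 1, the value of (0,1,0) on bᵢ. -/
theorem sum_sub_mem_dualMonoid_of_det_ne_zero
    (a : Fin 3 → dualMonoid (latticeCone (conifoldRays p q)))
    (ha : Matrix.det (.of fun i j => (a i : Fin 3 → ℤ) j) ≠ 0) :
    ∑ i, (a i : Fin 3 → ℤ) - Pi.single 1 1 ∈ dualMonoid (latticeCone (conifoldRays p q)) := by
  refine mem_dualMonoid_latticeCone.2 fun i => ?_
  have hnn (j) := mem_dualMonoid_latticeCone.1 (a j).2 i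
  rw [sub_dotProduct, sum_dotProduct, single_dotProduct, conifoldRays_one, _root_.mul_one,
    sub_nonneg]
  by_contra! hlt
  have hz : ∑ j, (a j : Fin 3 → ℤ) ⬝ᵥ conifoldRays p q i = 0 :=
    le_antisymm (Int.lt_add_one_iff.1 hlt) (Finset.sum_nonneg fun j _ => hnn j)
  rw [Finset.sum_eq_zero_iff_of_nonneg fun j _ => hnn j] at hz
  refine ha (Matrix.exists_mulVec_eq_zero_iff.1 ⟨conifoldRays p q i, fun h => ?_, ?_⟩)
  · have := congrFun h 1
    rw [conifoldRays_one] at this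
    exact one_ne_zero this
  · ext j
    exact hz j (Finset.mem_univ j)

/-- For each bᵢ there is an independent triple in S_σ whose sum pairs to exactly 1 with bᵢ: two
vectors on the facet bᵢ = 0 together with (0,1,0). -/
theorem add_mem_dualMonoid_of_forall_det_ne_zero (hp : p ≠ 0) (k : Fin 3 → ℤ)
    (hk : ∀ a : Fin 3 → dualMonoid (latticeCone (conifoldRays p q)),
      Matrix.det (.of fun i j => (a i : Fin 3 → ℤ) j) ≠ 0 →
        k + ∑ i, (a i : Fin 3 → ℤ) ∈ dualMonoid (latticeCone (conifoldRays p q))) :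
    k + Pi.single 1 1 ∈ dualMonoid (latticeCone (conifoldRays p q)) := by
  -- `x`, `y`, `z`, `t` are the exponents of the p-th powers of the conifold coordinates, and `m` is
  -- that of xy = zt. They vanish on b₃ and b₄, b₁ and b₂, b₂ and b₃, b₁ and b₄ respectively, while
  -- `m` is 1 on all four.
  let x : dualMonoid (latticeCone (conifoldRays p q)) := ⟨![-1, p, 0], by
    simp [mem_dualMonoid_conifoldCone]⟩
  let y : dualMonoid (latticeCone (conifoldRays p q)) := ⟨![1, 0, 0], by
    simp [mem_dualMonoid_conifoldCone]⟩
  let z : dualMonoid (latticeCone (conifoldRays p q)) := ⟨![-q, p + q * p, -p], by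
    rw [mem_dualMonoid_conifoldCone]
    refine ⟨?_, ?_, ?_, ?_⟩ <;> simp <;> nlinarith⟩
  let t : dualMonoid (latticeCone (conifoldRays p q)) := ⟨![q, -(q * p), p], by
    rw [mem_dualMonoid_conifoldCone]
    refine ⟨?_, ?_, ?_, ?_⟩ <;> simp <;> nlinarith⟩
  let m : dualMonoid (latticeCone (conifoldRays p q)) := ⟨![0, 1, 0], by
    simp [mem_dualMonoid_conifoldCone]⟩
  have h0 := mem_dualMonoid_conifoldCone.1 (hk ![m, y, t] (by
    simp [Matrix.det_fin_three, m, y, t, hp]))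
  have h1 := mem_dualMonoid_conifoldCone.1 (hk ![m, y, z] (by
    simp [Matrix.det_fin_three, m, y, z, hp]))
  have h2 := mem_dualMonoid_conifoldCone.1 (hk ![m, x, z] (by
    simp [Matrix.det_fin_three, m, x, z, hp]))
  have h3 := mem_dualMonoid_conifoldCone.1 (hk ![m, x, t] (by
    simp [Matrix.det_fin_three, m, x, t, hp]))
  rw [mem_dualMonoid_conifoldCone]
  have h0 := h0.1
  have h1 := h1.2.1
  have h2 := h2.2.2.1
  have h3 := h3.2.2.2
  simp [Fin.sum_univ_three, m, x, y, z, t] at h0 h1 h2 h3 ⊢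
  refine ⟨?_, ?_, ?_, ?_⟩ <;> linarith

/-- The functions on the quotient of the conifold as Laurent polynomials. -/
def invariantsToTorus (hp : p ≠ 0) :
    conifoldInvariants p q →ₐ[ℂ] AddMonoidAlgebra ℂ (Fin 3 → ℤ) :=
  (AddMonoidAlgebra.mapDomainAlgHom ℂ ℂ
    (dualMonoid (latticeCone (conifoldRays p q))).subtype).comp (invariantsEquiv hp).toAlgHom

theorem nonempty_canonicalSheaf_iso (hp : p ≠ 0) :
    Nonempty (canonicalSheaf 3 (conifoldInvariants p q) ≅
      (SheafOfModules.unit _ :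
        (Spec (CommRingCat.of (conifoldInvariants p q))).Modules)) := by
  let := (invariantsToTorus (p := p) (q := q) hp).toRingHom.toAlgebra
  have : IsScalarTower ℂ (conifoldInvariants p q) (AddMonoidAlgebra ℂ (Fin 3 → ℤ)) :=
    .of_algebraMap_eq fun c => ((invariantsToTorus (p := p) (q := q) hp).commutes c).symm
  have h : IsSemigroupRing (conifoldInvariants p q)
      (dualMonoid (latticeCone (conifoldRays p q))) := by
    refine ⟨?_, fun f => ?_⟩
    · exact (AddMonoidAlgebra.mapDomain_injective Subtype.val_injective).comp
        (invariantsEquiv hp).injective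
    · have := AddMonoidAlgebra.mem_range_mapDomainAlgHom_iff
        (dualMonoid (latticeCone (conifoldRays p q))).subtype f
      simp only [AddSubmonoid.coe_subtype, Subtype.range_coe_subtype, Set.mem_ofPred_eq] at this
      rw [← this]
      constructor
      · rintro ⟨r, rfl⟩
        exact ⟨invariantsEquiv hp r, rfl⟩
      · rintro ⟨r, rfl⟩
        refine ⟨(invariantsEquiv hp).symm r, ?_⟩
        change AddMonoidAlgebra.mapDomainAlgHom ℂ ℂ _ (invariantsEquiv hp _) = _
        rw [AlgEquiv.apply_symm_apply]
        rfl
  obtain ⟨e⟩ := h.nonempty_dual_dual_exteriorPower_equiv single_mem_dualMonoid_conifoldCone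
    (Pi.single 1 1) sum_sub_mem_dualMonoid_of_det_ne_zero
    (add_mem_dualMonoid_of_forall_det_ne_zero hp)
  exact ⟨(tilde.functor (CommRingCat.of (conifoldInvariants p q))).mapIso e.toModuleIso ≪≫
    tildeSelf⟩

/-- `Spec` of an isomorphism of `R`-algebras. -/
def specIsoOfAlgEquiv {R A B : Type} [CommRing R] [CommRing A] [CommRing B] [Algebra R A]
    [Algebra R B] (e : A ≃ₐ[R] B) :
    (Spec (.of A)).asOver (Spec (.of R)) ≅ (Spec (.of B)).asOver (Spec (.of R)) where
  hom := (Spec.map (CommRingCat.ofHom e.symm.toAlgHom.toRingHom)).asOver _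
  inv := (Spec.map (CommRingCat.ofHom e.toAlgHom.toRingHom)).asOver _
  hom_inv_id := by
    apply Over.OverMorphism.ext
    change Spec.map _ ≫ Spec.map _ = 𝟙 _
    rw [← Spec.map_comp, ← CommRingCat.ofHom_comp, ← Spec.map_id]
    congr 1
    ext x
    exact e.symm_apply_apply x
  inv_hom_id := by
    apply Over.OverMorphism.ext
    change Spec.map _ ≫ Spec.map _ = 𝟙 _
    rw [← Spec.map_comp, ← CommRingCat.ofHom_comp, ← Spec.map_id]
    congr 1
    ext x
    exact e.apply_symm_apply x

/-- The quotient of the conifold is the toric variety `U_σ`. -/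
def conifoldQuotientIso (hp : p ≠ 0) :
    conifoldQuotient p q ≅ affineToric (latticeCone (conifoldRays p q)) :=
  specIsoOfAlgEquiv (invariantsEquiv hp)

/-- Adding (0,1,0) raises every pairing with a ray generator by 1, so the sum of the absolute values
of the pairings of k is a sufficient number of steps. -/
theorem exists_interior_translate (k : Fin 3 → ℤ) :
    ∃ N : ℕ, k + N • (Pi.single 1 1 : Fin 3 → ℤ) ∈
      dualMonoid (latticeCone (conifoldRays p q)) := by
  let c (i : Fin 4) := k ⬝ᵥ conifoldRays p q i
  refine ⟨∑ i, (c i).natAbs, mem_dualMonoid_latticeCone.2 fun i => ?_⟩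
  rw [add_dotProduct, smul_dotProduct, single_dotProduct, conifoldRays_one]
  have : (c i).natAbs ≤ ∑ i, (c i).natAbs :=
    Finset.single_le_sum (f := fun i => (c i).natAbs) (fun _ _ => Nat.zero_le _)
      (Finset.mem_univ i)
  simp only [_root_.mul_one, nsmul_eq_mul]
  change 0 ≤ c i + _
  omega

end Main

end

theorem mainTheorem5 (p q : ℕ) (hq : 1 ≤ q) (hqp : q < p) (hpq : Nat.Coprime p q) :
    -- the quotient is a normal variety
    IsNormalVariety (conifoldQuotient p q) ∧
    -- it is toric, and its fan consists of the cone on the given rays and the faces of that cone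
    ((latticeCone (conifoldRays p q) : ConvexCone ℝ (Fin 3 → ℝ)).Salient ∧
      rayGenerators (latticeCone (conifoldRays p q)) = Set.range (conifoldRays p q) ∧
      ∃ (j : TorusEmbedding 3 (conifoldQuotient p q))
        (e : conifoldQuotient p q ≅ affineToric (latticeCone (conifoldRays p q))),
        j.emb ≫ e.hom = affineToricEmb (latticeCone (conifoldRays p q))) ∧
    -- the ray generators lie on a common affine hyperplane at lattice height one
    (∃ m : Fin 3 → ℤ, ∀ i, m ⬝ᵥ conifoldRays p q i = 1) ∧
    -- the canonical sheaf is trivial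
    Nonempty (canonicalSheaf 3 (conifoldInvariants p q) ≅
      (SheafOfModules.unit _ :
        (Spec (CommRingCat.of (conifoldInvariants p q))).Modules)) := by
  have hp : p ≠ 0 := by omega
  refine ⟨isNormalVariety_conifoldQuotient hp, ⟨salient_conifoldCone,
    rayGenerators_conifoldCone (Nat.pos_of_ne_zero hp), ?_⟩, ⟨Pi.single 1 1, fun i => ?_⟩,
    nonempty_canonicalSheaf_iso hp⟩
  · obtain ⟨j, hj⟩ := exists_torusEmbedding_of_iso (affineToricEmb _)
      (isOpenImmersion_affineToricEmb _ ⟨_, single_mem_dualMonoid_conifoldCone 1⟩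
        exists_interior_translate) (conifoldQuotientIso hp)
    exact ⟨j, _, hj⟩
  · rw [single_dotProduct, conifoldRays_one, _root_.mul_one]
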